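/- **Setting.** Phase space of $n$ bosonic modes is $\mathbb R^{2n}$ with coordinates $(q_1,p_1,\dots,q_n,p_n)$ and symplectic form $\Omega=\bigoplus_{k=1}^n\begin{pmatrix}0&1\\-1&0\end{pmatrix}$; a real matrix $S$ is symplectic if $S\Omega S^\top=\Omega$. An oscillator-to-oscillator (O2O) code with Gaussian encoding encodes $N\ge 1$ data modes into $N+M$ modes, using $M\ge 0$ ancilla modes in an arbitrary state and a symplectic matrix $S\in \mathrm{Sp}(2(N+M),\mathbb R)$. The encoded modes suffer i.i.d. additive Gaussian noise: a random displacement $\xi\sim\mathcal N(0,\sigma^2 I_{2(N+M)})$ with $\sigma>0$. Decoding by $S^{-1}$ leaves the correlated data and ancilla noise $x=(x_d,x_a)=S^{-1}\xi\in\mathbb R^{2N}\times\mathbb R^{2M}$, with covariance matrix $V_x=\sigma^2S^{-1}S^{-\top}$. The ancilla modes, displaced by $x_a$, are then measured; the resulting syndrome $s$, with values in an arbitrary measurable space, is drawn from an arbitrary Markov kernel $\kappa(x_a,\cdot)$ (every ancilla state and every measurement of the ancilla modes gives such a kernel). An estimator is a measurable function $f$ of $s$ with values in $\mathbb R^{2N}$;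 the residual data noise is $x_{\rm out}=x_d-f(s)$, its matrix of second moments is $(V_{\rm out})_{ij}=\mathbb E[x_{{\rm out},i}\,x_{{\rm out},j}]$, and $\bar\sigma_{\rm RMS}^2=\operatorname{Tr}V_{\rm out}/(2N)$ (equal to $\infty$ if the second moments are not finite). **Gains.** Real numbers $G_1,\dots,G_N\ge 1$ (with $G_i=1$ for $i>M$) are called *reduction gains* of the code if there are symplectic matrices $A\in\mathrm{Sp}(2N,\mathbb R)$ and $B\in\mathrm{Sp}(2M,\mathbb R)$ with $$(A\oplus B)\,V_x\,(A\oplus B)^\top=\sigma^2\,T\,T^\top ,$$ where $T$ is the product, over $i\le\min(N,M)$, of the two-mode squeezers $$S_{G_i}=\begin{pmatrix}\sqrt{G_i}\,I&\sqrt{G_i-1}\,Z\\ \sqrt{G_i-1}\,Z&\sqrt{G_i}\,I\end{pmatrix},\qquad Z=\operatorname{diag}(1,-1),$$ acting between the $i$-th data mode and the $i$-th ancilla mode, and $T$ is the identity on all other modes. **Theorem.** Every such code has reduction gains. For all reduction gains $G_1,\dots,G_N$ of the code, every syndrome kernel $\kappa$ and every estimator $f$, $$\bar\sigma_{\rm RMS}^2\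 \ge\ \frac1N\sum_{i=1}^N\frac{\sigma^2}{2G_i-1}.$$ Consequently there is no threshold at finite squeezing: if the average gain satisfies $\frac1N\sum_{i=1}^N G_i\le\Gamma$, then $\bar\sigma_{\rm RMS}^2\ge\sigma^2/(2\Gamma-1)>0$, a bound that depends neither on the ancilla state, the measurement or the estimator, nor on the number $M$ of ancilla modes. -/

import Mathlib

open MeasureTheory ProbabilityTheory Matrix
open scoped ENNReal Kronecker

noncomputable section

namespace O2O

/-- The quadratures of `n` bosonic modes: `(k, 0)` is the position `q_k` and `(k, 1)` is the
momentum `p_k` of mode `k`. -/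
abbrev Quad (n : ℕ) : Type := Fin n × Fin 2

/-- The quadratures of `N` data modes together with `M` ancilla modes. -/
abbrev JointQuad (N M : ℕ) : Type := Quad N ⊕ Quad M

/-- The `n`-mode symplectic form `⨁ₖ !![0, 1; -1, 0]`. -/
def symplForm (n : ℕ) : Matrix (Quad n) (Quad n) ℝ :=
  (1 : Matrix (Fin n) (Fin n) ℝ) ⊗ₖ !![0, 1; -1, 0]

/-- The symplectic form of the `N + M` modes, data modes first. -/
def jointSymplForm (N M : ℕ) : Matrix (JointQuad N M) (JointQuad N M) ℝ :=
  fromBlocks (symplForm N) 0 0 (symplForm M)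

/-- `S` is a real symplectic matrix on `n` modes: `S Ω Sᵀ = Ω`. -/
def IsSymplectic {n : ℕ} (S : Matrix (Quad n) (Quad n) ℝ) : Prop :=
  S * symplForm n * Sᵀ = symplForm n

/-- `S` is a real symplectic matrix on the joint phase space of data and ancilla modes. -/
def IsJointSymplectic {N M : ℕ} (S : Matrix (JointQuad N M) (JointQuad N M) ℝ) : Prop :=
  S * jointSymplForm N M * Sᵀ = jointSymplForm N M

/-- The Pauli matrix `Z = diag(1, -1)`, acting on one pair `(q, p)`. -/
def pauliZ : Matrix (Fin 2) (Fin 2) ℝ := !![1, 0; 0, -1]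

/-- The product of two-mode squeezers: for each `i` with `i < N` and `i < M`, the matrix
`S_G = (√G I, √(G-1) Z; √(G-1) Z, √G I)` of gain `G = G i` acts between the `i`-th data mode and
the `i`-th ancilla mode, and the identity acts on the ancilla modes `j ≥ N`.
(When `N > M`, the data modes `i ≥ M` have no partner; there the reduction below requires
`G i = 1`, so the identity acts on them too.) -/
def tmsProduct {N M : ℕ} (G : Fin N → ℝ) : Matrix (JointQuad N M) (JointQuad N M) ℝ :=
  let c : Matrix (Fin N) (Fin M) ℝ :=
    Matrix.of fun i j => if (i : ℕ) = (j : ℕ) then √(G i - 1) else 0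
  let dA : Fin N → ℝ := fun i => √(G i)
  let dB : Fin M → ℝ := fun j => if h : (j : ℕ) < N then √(G ⟨j, h⟩) else 1
  fromBlocks (diagonal dA ⊗ₖ (1 : Matrix (Fin 2) (Fin 2) ℝ)) (c ⊗ₖ pauliZ)
    (cᵀ ⊗ₖ pauliZ) (diagonal dB ⊗ₖ (1 : Matrix (Fin 2) (Fin 2) ℝ))

/-- The covariance matrix `V_x = σ² S⁻¹ S⁻ᵀ` of the correlated data and ancilla noises, left
after iid additive Gaussian noise of variance `σ²` between encoding `S` and decoding `S⁻¹`. -/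
def noiseCov {N M : ℕ} (S : Matrix (JointQuad N M) (JointQuad N M) ℝ) (σ : ℝ) :
    Matrix (JointQuad N M) (JointQuad N M) ℝ :=
  σ ^ 2 • (S⁻¹ * (S⁻¹)ᵀ)

/-- `G` is a family of two-mode-squeezing gains of the code with encoding `S`, obtained by
code reduction: local symplectic matrices `A` (on the data) and `B` (on the ancilla) bring
`V_x` to the form `σ² T Tᵀ`, where `T` is the product of two-mode squeezers of gains `G i ≥ 1`. -/
def IsReductionGains {N M : ℕ} (S : Matrix (JointQuad N M) (JointQuad N M) ℝ) (σ : ℝ)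
    (G : Fin N → ℝ) : Prop :=
  (∀ i, 1 ≤ G i) ∧ (∀ i : Fin N, M ≤ (i : ℕ) → G i = 1) ∧
  ∃ (A : Matrix (Quad N) (Quad N) ℝ) (B : Matrix (Quad M) (Quad M) ℝ),
    IsSymplectic A ∧ IsSymplectic B ∧
    fromBlocks A 0 0 B * noiseCov S σ * (fromBlocks A 0 0 B)ᵀ =
      σ ^ 2 • (tmsProduct (M := M) G * (tmsProduct (M := M) G)ᵀ)

/-- The law of the displacement `ξ` of iid additive Gaussian noise: all quadratures are
independent, with law `N(0, σ²)`. -/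
def agn (N M : ℕ) (σ : ℝ) : Measure (JointQuad N M → ℝ) :=
  Measure.pi fun _ => gaussianReal 0 (σ ^ 2).toNNReal

/-- The law of the noise `x = (x_d, x_a) = S⁻¹ ξ` after decoding. -/
def decodedNoise {N M : ℕ} (S : Matrix (JointQuad N M) (JointQuad N M) ℝ) (σ : ℝ) :
    Measure (JointQuad N M → ℝ) :=
  (agn N M σ).map fun ξ => S⁻¹ *ᵥ ξ

/-- The ancilla noise `x_a`, as a function of the total noise `x`. -/
def ancillaPart {N M : ℕ} (x : JointQuad N M → ℝ) : Quad M → ℝ := fun j => x (Sum.inr j)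

theorem measurable_ancillaPart {N M : ℕ} : Measurable (ancillaPart (N := N) (M := M)) :=
  measurable_pi_lambda _ fun j => measurable_pi_apply (Sum.inr j)

variable {N M : ℕ} {Y : Type*} [MeasurableSpace Y]

/-- The joint law of the noise `x` and of the syndrome `s`. The Markov kernel `κ` gives the law
`κ x_a` of the outcome of the syndrome measurement on the ancilla modes, when these have been
displaced by `x_a`. Every ancilla state and every measurement of the ancilla modes yields such a
kernel (Born's rule); a noiseless syndrome `s = R(x_a)` is the case of a deterministic kernel. -/
def noiseSyndromeLaw (S : Matrix (JointQuad N M) (JointQuad N M) ℝ) (σ : ℝ)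
    (κ : Kernel (Quad M → ℝ) Y) : Measure ((JointQuad N M → ℝ) × Y) :=
  decodedNoise S σ ⊗ₘ κ.comap ancillaPart measurable_ancillaPart

/-- The residual data noise `x_out = x_d - f(s)` after the correction by the estimate `f(s)`. -/
def residual (f : Y → Quad N → ℝ) (z : (JointQuad N M → ℝ) × Y) : Quad N → ℝ :=
  fun i => z.1 (Sum.inl i) - f z.2 i

/-- The output covariance matrix `V_out`: the second moments of the residual data noise. -/
def outputCov (S : Matrix (JointQuad N M) (JointQuad N M) ℝ) (σ : ℝ)
    (κ : Kernel (Quad M → ℝ) Y) (f : Y → Quad N → ℝ) : Matrix (Quad N) (Quad N) ℝ :=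
  Matrix.of fun i j => ∫ z, residual f z i * residual f z j ∂(noiseSyndromeLaw S σ κ)

open Classical in
/-- The squared RMS error `Tr V_out / (2N)`, with value `∞` if the residual data noise does not
have finite second moments. -/
def rmsErrorSq (S : Matrix (JointQuad N M) (JointQuad N M) ℝ) (σ : ℝ)
    (κ : Kernel (Quad M → ℝ) Y) (f : Y → Quad N → ℝ) : ℝ≥0∞ :=
  if ∀ i, Integrable (fun z => residual f z i ^ 2) (noiseSyndromeLaw S σ κ) then
    ENNReal.ofReal ((outputCov S σ κ f).trace / (2 * N))
  else ⊤

end O2O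

end

/-! The bound combines Gaussian regression with the normal form of a pure bipartite covariance
matrix. Write `x_d = K x_a + w`, with `K` the regression matrix. For Gaussian noise `w` is
independent of `x_a`, and the syndrome sees the noise only through `x_a`, so no estimator can reduce
`w`: the mean square of each residual quadrature is at least that of `w`, a diagonal entry of the
Schur complement of `V_x` (`integral_residual_sq_ge`). In reduced coordinates this complement is
diagonal with entries `σ² / (2 G_i - 1)` (`squeezedCov_regression`). Undoing the reduction only
applies the congruence by the symplectic `A⁻¹`, which cannot lower the trace of such a diagonal
matrix (`two_mul_sum_le_trace`). Convexity of `1 / y` then gives the bound in the average gain.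

Existence of gains is the modewise decomposition of pure Gaussian states. The matrix `V = S⁻¹ S⁻ᵀ`
satisfies `V Ω V = Ω`. Williamson's theorem diagonalizes its data block. The block equations then
force the rows of the data-ancilla correlations to span normal planes of the ancilla block, with the
same symplectic eigenvalues, and `IsNormalFamily.extend` completes these planes to a Williamson
basis of the ancilla (`exists_ancilla_reduction`). -/

namespace O2O

/-! ### Williamson normal form, in extendable form -/

/-- On a nonzero invariant subspace, an operator that is symmetric for a positive definite form has
an eigenvector. -/
theorem exists_eigenvector_mem {X : Type*} [AddCommGroup X] [Module ℝ X] [FiniteDimensional ℝ X]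
    (g : LinearMap.BilinForm ℝ X) (hsymm : ∀ x y, g x y = g y x) (hpos : ∀ x, x ≠ 0 → 0 < g x x)
    (T : X →ₗ[ℝ] X) (hT : ∀ x y, g (T x) y = g x (T y))
    (F : Submodule ℝ X) (hF : ∀ x ∈ F, T x ∈ F) (hne : F ≠ ⊥) :
    ∃ μ : ℝ, ∃ e ∈ F, e ≠ 0 ∧ T e = μ • e := by
  have hnn : ∀ x, 0 ≤ g x x := fun x => by
    by_cases hx : x = 0
    · simp [hx]
    · exact (hpos x hx).le
  let c : InnerProductSpace.Core ℝ X :=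
    { inner := fun x y => g x y
      conj_inner_symm := fun x y => by simpa using! hsymm y x
      re_inner_nonneg := fun x => by simpa using! hnn x
      add_left := fun x y z => by simp
      smul_left := fun x y r => by simp
      definite := fun x h => by
        by_contra hx
        exact (hpos x hx).ne' h }
  let _ : NormedAddCommGroup X := c.toNormedAddCommGroup
  let _ : InnerProductSpace ℝ X := InnerProductSpace.ofCore c.toCore
  have : Nontrivial F := (Submodule.nontrivial_iff_ne_bot).2 hne
  have hsym : (T.restrict hF).IsSymmetric := fun x y => hT x y
  -- With `g` as inner product, the supremum of the Rayleigh quotient on `F` is an eigenvalue.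
  obtain ⟨e, he⟩ := (hsym.hasEigenvalue_iSup_of_finiteDimensional).exists_hasEigenvector
  exact ⟨_, e, e.2, fun h => he.2 (Subtype.ext h), congrArg Subtype.val he.apply_eq_smul⟩

/-- `(e, f)` is a symplectic pair for `ω` that spans an invariant plane of the positive form `g`,
on which `g` is `ν` times the identity. -/
def IsNormalPair {X : Type*} [AddCommGroup X] [Module ℝ X] (ω g : LinearMap.BilinForm ℝ X)
    (ν : ℝ) (e f : X) : Prop :=
  ω e f = 1 ∧ (∀ x, g x e = ν * ω x f) ∧ ∀ x, g x f = -ν * ω x e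

/-- The pairs `(u i, v i)`, `i ∈ s`, are symplectically orthogonal normal pairs. -/
def IsNormalFamily {X ι : Type*} [AddCommGroup X] [Module ℝ X] (ω g : LinearMap.BilinForm ℝ X)
    (s : Finset ι) (ν : ι → ℝ) (u v : ι → X) : Prop :=
  (∀ i ∈ s, IsNormalPair ω g (ν i) (u i) (v i)) ∧
    ∀ i ∈ s, ∀ j ∈ s, i ≠ j → ω (u i) (u j) = 0 ∧ ω (u i) (v j) = 0 ∧ ω (v i) (v j) = 0

section Normal

variable {X ι : Type*} [AddCommGroup X] [Module ℝ X] {ω g : LinearMap.BilinForm ℝ X}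

theorem IsNormalPair.pos {ν : ℝ} {e f : X} (hpos : ∀ x, x ≠ 0 → 0 < g x x)
    (h : IsNormalPair ω g ν e f) : 0 < ν := by
  have he : e ≠ 0 := by
    rintro rfl
    simpa using h.1
  have := hpos e he
  rwa [h.2.1, h.1, mul_one] at this

/-- A nonzero subspace of vectors, closed under the operator `K` representing `ω` with respect to
`g`, contains a normal pair. -/
theorem exists_isNormalPair [FiniteDimensional ℝ X]
    (hω : ∀ x y, ω x y = -ω y x) (hnd : ∀ x, (∀ y, ω x y = 0) → x = 0)
    (hsymm : ∀ x y, g x y = g y x) (hpos : ∀ x, x ≠ 0 → 0 < g x x)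
    (K : X →ₗ[ℝ] X) (hK : ∀ x y, g x (K y) = ω x y)
    (F : Submodule ℝ X) (hF : ∀ x ∈ F, K x ∈ F) (hne : F ≠ ⊥) :
    ∃ ν : ℝ, ∃ e ∈ F, ∃ f ∈ F, IsNormalPair ω g ν e f := by
  have hskew : ∀ x y, g (K x) y = -g x (K y) := fun x y => by
    rw [hsymm, hK, hK, hω]
  -- `K` is skew for `g`, so its square is symmetric; an eigenvector `e` of the square spans with `K
  -- e` an invariant plane.
  obtain ⟨μ, e, heF, he0, he⟩ := exists_eigenvector_mem g hsymm hpos (K ∘ₗ K)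
    (fun x y => by simp [hskew]) F (fun x hx => hF _ (hF x hx)) hne
  have he : K (K e) = μ • e := he
  have hKe : K e ≠ 0 := fun h => he0 (hnd e fun y => by rw [hω, ← hK, h]; simp)
  have hg := hpos e he0
  have hμ : μ < 0 := by
    have h1 : μ * g e e = -g (K e) (K e) := by
      rw [hskew, he]; simp
    have h2 := hpos _ hKe
    nlinarith
  -- For `f = -(a⁻¹ t) K e` one finds `ω (t e) f = a t² g e e`; this is `1` exactly when `t² g e e =
  -- a⁻¹`. The symplectic eigenvalue is `a⁻¹`.
  obtain ⟨a, ha, ha2⟩ : ∃ a : ℝ, 0 < a ∧ a * a = -μ :=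
    ⟨√(-μ), Real.sqrt_pos.2 (by linarith), Real.mul_self_sqrt (by linarith)⟩
  obtain ⟨t, ht⟩ : ∃ t : ℝ, t * t * g e e = a⁻¹ := by
    refine ⟨√(a⁻¹ / g e e), ?_⟩
    rw [Real.mul_self_sqrt (by positivity)]
    field_simp
  have hμ' : μ = -(a * a) := by linarith
  refine ⟨a⁻¹, t • e, F.smul_mem _ heF, -(a⁻¹ * t) • K e, F.smul_mem _ (hF e heF), ?_, ?_, ?_⟩
  · rw [← hK]
    simp only [map_smul, LinearMap.smul_apply, smul_eq_mul, he, hμ']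
    have : -(a⁻¹ * t) * (-(a * a) * (t * g e e)) = (a⁻¹ * a) * a * (t * t * g e e) := by ring
    rw [this, ht, inv_mul_cancel₀ ha.ne', one_mul, mul_inv_cancel₀ ha.ne']
  · intro x
    rw [← hK]
    simp only [map_smul, smul_eq_mul, he, hμ']
    field_simp
  · intro x
    rw [← hK]
    simp only [map_smul, smul_eq_mul]
    ring

/-- Every symplectically orthogonal family of normal pairs extends to a symplectic basis of
normal pairs. For the empty family this is Williamson's theorem. -/
theorem IsNormalFamily.extend [FiniteDimensional ℝ X] [Fintype ι] [DecidableEq ι]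
    (hω : ∀ x y, ω x y = -ω y x) (hnd : ∀ x, (∀ y, ω x y = 0) → x = 0)
    (hsymm : ∀ x y, g x y = g y x) (hpos : ∀ x, x ≠ 0 → 0 < g x x)
    (hdim : Module.finrank ℝ X = 2 * Fintype.card ι) {s : Finset ι} {ν : ι → ℝ} {u v : ι → X}
    (h : IsNormalFamily ω g s ν u v) :
    ∃ (ν' : ι → ℝ) (u' v' : ι → X), IsNormalFamily ω g Finset.univ ν' u' v' ∧
      ∀ i ∈ s, ν' i = ν i ∧ u' i = u i ∧ v' i = v i := by
  have hgnd : g.Nondegenerate := by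
    refine ⟨fun x hx => ?_, fun x hx => ?_⟩ <;>
    · by_contra h0
      exact (hpos x h0).ne' (hx x)
  obtain ⟨K, hK⟩ : ∃ K : X →ₗ[ℝ] X, ∀ x y, g x (K y) = ω x y :=
    ⟨-(LinearMap.BilinForm.symmCompOfNondegenerate ω g hgnd), fun x y => by
      rw [hsymm, LinearMap.neg_apply, map_neg, LinearMap.neg_apply,
        LinearMap.BilinForm.symmCompOfNondegenerate_left_apply, hω x y]⟩
  induction hn : (sᶜ).card generalizing s ν u v with
  | zero =>
    have hs : s = Finset.univ := by
      rw [Finset.card_eq_zero] at hn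
      exact (Finset.compl_eq_empty_iff s).1 hn
    subst hs
    exact ⟨ν, u, v, h, fun i _ => ⟨rfl, rfl, rfl⟩⟩
  | succ n ih =>
    obtain ⟨k, hk⟩ : (sᶜ).Nonempty := Finset.card_pos.1 (by omega)
    have hks : k ∉ s := by simpa using hk
    -- The kernel of `Φ` is the symplectic complement of the pairs already chosen. It is nonzero
    -- because `2 |s|` is less than the dimension.
    let Φ : X →ₗ[ℝ] (s → ℝ) × (s → ℝ) :=
      (LinearMap.pi fun i : s => ω (u i)).prod (LinearMap.pi fun i : s => ω (v i))
    have hmem : ∀ x, x ∈ LinearMap.ker Φ ↔ ∀ i ∈ s, ω (u i) x = 0 ∧ ω (v i) x = 0 := by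
      intro x
      simp [Φ, LinearMap.mem_ker, funext_iff, forall_and]
    have hker : LinearMap.ker Φ ≠ ⊥ := by
      apply LinearMap.ker_ne_bot_of_finrank_lt
      have := Finset.card_add_card_compl s
      simp only [Module.finrank_prod, Module.finrank_fintype_fun_eq_card, Fintype.card_coe, hdim]
      omega
    obtain ⟨ν₀, e, he, f, hf, hef⟩ := exists_isNormalPair hω hnd hsymm hpos K hK (LinearMap.ker Φ)
      -- The complement is `K`-invariant: `g (K x) (u i)` equals both `ω (u i) x = 0` and `ν i * ω
      -- (K x) (v i)`, with `ν i > 0`; likewise with `u` and `v` exchanged.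
      (fun x hx => by
        rw [hmem] at hx ⊢
        intro i hi
        obtain ⟨h1, h2⟩ := hx i hi
        have hp := h.1 i hi
        rw [← hK] at h1 h2
        have e1 := hp.2.1 (K (x))
        have e2 := hp.2.2 (K (x))
        rw [hsymm, h1] at e1
        rw [hsymm, h2] at e2
        have := hp.pos hpos
        constructor
        · rw [hω]
          rcases mul_eq_zero.1 e2.symm with h | h <;> linarith
        · rw [hω]
          rcases mul_eq_zero.1 e1.symm with h | h <;> linarith) hker
    rw [hmem] at he hf
    have hupd : ∀ i ∈ s, i ≠ k := fun i hi hik => hks (hik ▸ hi)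
    have hnew : IsNormalFamily ω g (insert k s) (Function.update ν k ν₀) (Function.update u k e)
        (Function.update v k f) := by
      constructor
      · intro i hi
        rcases Finset.mem_insert.1 hi with rfl | hi
        · simpa using hef
        · simpa [hupd i hi] using h.1 i hi
      · intro i hi j hj hij
        rcases Finset.mem_insert.1 hi with hik | hi' <;>
          rcases Finset.mem_insert.1 hj with hjk | hj'
        · exact absurd (hik.trans hjk.symm) hij
        · subst hik
          have h1 := he j hj'
          have h2 := hf j hj'
          simp only [Function.update_self, Function.update_of_ne (hupd j hj')]
          refine ⟨?_, ?_, ?_⟩ <;> rw [hω] <;> simp [h1, h2]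
        · subst hjk
          have h1 := he i hi'
          have h2 := hf i hi'
          simp only [Function.update_self, Function.update_of_ne (hupd i hi')]
          exact ⟨h1.1, h2.1, h2.2⟩
        · simpa only [Function.update_of_ne (hupd i hi'), Function.update_of_ne (hupd j hj')] using
            h.2 i hi' j hj' hij
    obtain ⟨ν', u', v', hfam, hag⟩ := ih hnew (by
      rw [Finset.compl_insert, Finset.card_erase_of_mem hk]; omega)
    refine ⟨ν', u', v', hfam, fun i hi => ?_⟩
    have := hag i (Finset.mem_insert_of_mem hi)
    simpa only [Function.update_of_ne (hupd i hi)] using this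

end Normal
-- Linear functions of an iid Gaussian vector
section Gaussian

variable {ι : Type*} [Fintype ι]

theorem hasGaussianLaw_pi_gaussianReal (v : NNReal) :
    HasGaussianLaw (fun ξ : ι → ℝ => ξ) (Measure.pi fun _ => gaussianReal 0 v) :=
  iIndepFun.hasGaussianLaw (X := fun i (ξ : ι → ℝ) => ξ i)
    (fun i => ⟨by
      rw [(measurePreserving_eval (fun _ : ι => gaussianReal 0 v) i).map_eq]
      infer_instance⟩)
    (iIndepFun_pi (μ := fun _ : ι => gaussianReal 0 v) (X := fun _ x => x) fun _ => aemeasurable_id)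

theorem hasGaussianLaw_eval_pi_gaussianReal (v : NNReal) (i : ι) :
    HasGaussianLaw (fun ξ : ι → ℝ => ξ i) (Measure.pi fun _ => gaussianReal 0 v) :=
  (hasGaussianLaw_pi_gaussianReal v).map_fun (ContinuousLinearMap.proj (R := ℝ) (φ := fun _ : ι => ℝ) i)

theorem integral_eval_pi_gaussianReal (v : NNReal) (i : ι) :
    ∫ ξ : ι → ℝ, ξ i ∂(Measure.pi fun _ => gaussianReal 0 v) = 0 := by
  rw [integral_comp_eval (μ := fun _ : ι => gaussianReal 0 v) (i := i) (f := fun x => x)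
    aestronglyMeasurable_id]
  exact integral_id_gaussianReal

theorem integral_eval_mul_eval_pi_gaussianReal [DecidableEq ι] (v : NNReal) (i j : ι) :
    ∫ ξ : ι → ℝ, ξ i * ξ j ∂(Measure.pi fun _ => gaussianReal 0 v) = if i = j then (v : ℝ) else 0 := by
  split_ifs with h
  · subst h
    rw [integral_comp_eval (μ := fun _ : ι => gaussianReal 0 v) (i := i) (f := fun x => x * x)
      (by fun_prop)]
    have := variance_eq_sub (μ := gaussianReal 0 v) (X := id) (memLp_id_gaussianReal 2)
    rw [variance_id_gaussianReal] at this
    simp only [Pi.pow_apply, id, integral_id_gaussianReal] at this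
    simp [this, pow_two]
  · have hI : iIndepFun (fun i (ξ : ι → ℝ) => ξ i) (Measure.pi fun _ => gaussianReal 0 v) :=
      iIndepFun_pi (μ := fun _ : ι => gaussianReal 0 v) (X := fun _ x => x) fun _ => aemeasurable_id
    rw [(hI.indepFun h).integral_fun_mul_eq_mul_integral 
      (measurable_pi_apply i).aestronglyMeasurable (measurable_pi_apply j).aestronglyMeasurable,
      integral_eval_pi_gaussianReal, zero_mul]

theorem integral_dotProduct_pi_gaussianReal (v : NNReal) (a : ι → ℝ) :
    ∫ ξ : ι → ℝ, a ⬝ᵥ ξ ∂(Measure.pi fun _ => gaussianReal 0 v) = 0 := by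
  simp only [dotProduct]
  rw [integral_finsetSum _ fun i _ => (hasGaussianLaw_eval_pi_gaussianReal v i).integrable.const_mul _]
  simp [integral_const_mul, integral_eval_pi_gaussianReal]

theorem integral_dotProduct_mul_pi_gaussianReal (v : NNReal) (a b : ι → ℝ) :
    ∫ ξ : ι → ℝ, (a ⬝ᵥ ξ) * (b ⬝ᵥ ξ) ∂(Measure.pi fun _ => gaussianReal 0 v) = v * (a ⬝ᵥ b) := by
  classical
  have hint : ∀ i j, Integrable (fun ξ : ι → ℝ => a i * ξ i * (b j * ξ j))
      (Measure.pi fun _ => gaussianReal 0 v) := fun i j =>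
    ((hasGaussianLaw_eval_pi_gaussianReal v i).memLp_two.const_mul (a i)).integrable_mul
      ((hasGaussianLaw_eval_pi_gaussianReal v j).memLp_two.const_mul (b j))
  simp only [dotProduct, Finset.sum_mul_sum]
  rw [integral_finsetSum _ fun i _ => integrable_finsetSum _ fun j _ => hint i j]
  simp_rw [integral_finsetSum _ fun j _ => hint _ j]
  have : ∀ i j, ∫ ξ : ι → ℝ, a i * ξ i * (b j * ξ j) ∂(Measure.pi fun _ => gaussianReal 0 v)
      = a i * b j * if i = j then (v : ℝ) else 0 := fun i j => by
    rw [← integral_eval_mul_eval_pi_gaussianReal, ← integral_const_mul]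
    congr 1; ext ξ; ring
  simp [this, Finset.sum_mul, mul_comm (v : ℝ)]

theorem hasGaussianLaw_mulVec_pi_gaussianReal {κ : Type*} [Finite κ] (v : NNReal)
    (L : Matrix κ ι ℝ) :
    HasGaussianLaw (fun ξ : ι → ℝ => L *ᵥ ξ) (Measure.pi fun _ => gaussianReal 0 v) := by
  have := Fintype.ofFinite κ
  exact (hasGaussianLaw_pi_gaussianReal v).map_fun (LinearMap.toContinuousLinearMap L.mulVecLin)

theorem hasGaussianLaw_dotProduct_pi_gaussianReal (v : NNReal) (a : ι → ℝ) :
    HasGaussianLaw (fun ξ : ι → ℝ => a ⬝ᵥ ξ) (Measure.pi fun _ => gaussianReal 0 v) :=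
  (hasGaussianLaw_mulVec_pi_gaussianReal v (Matrix.of fun _ : Unit => a)).map_fun
    (ContinuousLinearMap.proj ())

/-- Uncorrelated linear functions of a standard Gaussian vector are independent. -/
theorem indepFun_dotProduct_mulVec_pi_gaussianReal {κ : Type*} [Finite κ] (v : NNReal)
    (a : ι → ℝ) (L : Matrix κ ι ℝ) (h : ∀ j, a ⬝ᵥ L j = 0) :
    IndepFun (fun ξ : ι → ℝ => a ⬝ᵥ ξ) (fun ξ => L *ᵥ ξ)
      (Measure.pi fun _ => gaussianReal 0 v) := by
  have := Fintype.ofFinite κ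
  -- The scalar is packed as a vector over `Unit`, to apply the criterion that jointly Gaussian
  -- vectors with zero cross-covariances are independent.
  have hG : HasGaussianLaw (fun ξ : ι → ℝ => (fun _ : Unit => a ⬝ᵥ ξ, fun j => L j ⬝ᵥ ξ))
      (Measure.pi fun _ => gaussianReal 0 v) :=
    (hasGaussianLaw_pi_gaussianReal v).map_fun (LinearMap.toContinuousLinearMap
      ((Matrix.of fun _ : Unit => a).mulVecLin.prod L.mulVecLin))
  have hI := hG.indepFun_of_covariance_eval fun _ j => by
    rw [covariance_eq_sub (hasGaussianLaw_dotProduct_pi_gaussianReal v a).memLp_two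
      (hasGaussianLaw_dotProduct_pi_gaussianReal v (L j)).memLp_two]
    simp [integral_dotProduct_pi_gaussianReal, integral_dotProduct_mul_pi_gaussianReal, h]
  exact hI.comp (measurable_pi_apply ()) measurable_id

end Gaussian
-- Optimality of linear regression
section Estimation

variable {N M : ℕ} {Y : Type*} [MeasurableSpace Y]

instance (σ : ℝ) : IsProbabilityMeasure (agn N M σ) := by
  unfold agn; infer_instance

theorem measurable_mulVec {ι κ : Type*} [Fintype ι] [Finite κ] (L : Matrix κ ι ℝ) :
    Measurable fun ξ : ι → ℝ => L *ᵥ ξ := by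
  have := Fintype.ofFinite κ
  exact L.mulVecLin.continuous_of_finiteDimensional.measurable

instance (S : Matrix (JointQuad N M) (JointQuad N M) ℝ) (σ : ℝ) :
    IsProbabilityMeasure (decodedNoise S σ) :=
  Measure.isProbabilityMeasure_map (measurable_mulVec _).aemeasurable

instance (S : Matrix (JointQuad N M) (JointQuad N M) ℝ) (σ : ℝ)
    (κ : Kernel (Quad M → ℝ) Y) [IsMarkovKernel κ] :
    IsProbabilityMeasure (noiseSyndromeLaw S σ κ) := by
  unfold noiseSyndromeLaw; infer_instance

theorem measurePreserving_fst_noiseSyndromeLaw (S : Matrix (JointQuad N M) (JointQuad N M) ℝ)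
    (σ : ℝ) (κ : Kernel (Quad M → ℝ) Y) [IsMarkovKernel κ] :
    MeasurePreserving Prod.fst (noiseSyndromeLaw S σ κ) (decodedNoise S σ) :=
  ⟨measurable_fst, Measure.fst_compProd _ _⟩

/-- If `V` is the covariance of `(X_d, X_a)` and `V_da = K V_aa`, then no estimator of `x_d` from
the syndrome has a smaller error than the linear regression `K x_a`. -/
theorem integral_residual_sq_ge (S : Matrix (JointQuad N M) (JointQuad N M) ℝ) {σ : ℝ}
    (hσ : 0 < σ) (K : Matrix (Quad N) (Quad M) ℝ)
    (hK : (noiseCov S σ).toBlocks₁₂ = K * (noiseCov S σ).toBlocks₂₂)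
    (κ : Kernel (Quad M → ℝ) Y) [IsMarkovKernel κ] (f : Y → Quad N → ℝ) (hf : Measurable f)
    (i : Quad N)
    (hint : Integrable (fun z => residual f z i ^ 2) (noiseSyndromeLaw S σ κ)) :
    ((noiseCov S σ).toBlocks₁₁ - K * (noiseCov S σ).toBlocks₂₁) i i ≤
      ∫ z, residual f z i ^ 2 ∂(noiseSyndromeLaw S σ κ) := by
  set ρ := noiseSyndromeLaw S σ κ with hρ
  set v : NNReal := (σ ^ 2).toNNReal with hv
  have hvσ : (v : ℝ) = σ ^ 2 := Real.coe_toNNReal _ (sq_nonneg σ)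
  -- the rows of the decoder that give the data noise, the ancilla noise, and their regression
  set Ld : Matrix (Quad N) (JointQuad N M) ℝ := S⁻¹.submatrix Sum.inl id with hLd
  set La : Matrix (Quad M) (JointQuad N M) ℝ := S⁻¹.submatrix Sum.inr id with hLa
  set W := Ld - K * La with hW
  have h11 : (noiseCov S σ).toBlocks₁₁ = σ ^ 2 • (Ld * Ldᵀ) := rfl
  have h12 : (noiseCov S σ).toBlocks₁₂ = σ ^ 2 • (Ld * Laᵀ) := rfl
  have h21 : (noiseCov S σ).toBlocks₂₁ = σ ^ 2 • (La * Ldᵀ) := rfl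
  have h22 : (noiseCov S σ).toBlocks₂₂ = σ ^ 2 • (La * Laᵀ) := rfl
  -- The hypothesis on `K` is the normal equation: the regression error `W ξ` is uncorrelated with
  -- the ancilla noise.
  have hWa : W * Laᵀ = 0 := by
    rw [h12, h22, Matrix.mul_smul] at hK
    have := smul_right_injective _ (pow_ne_zero 2 hσ.ne') hK
    rw [hW, Matrix.sub_mul, this, Matrix.mul_assoc, sub_self]
  have hWW : (noiseCov S σ).toBlocks₁₁ - K * (noiseCov S σ).toBlocks₂₁ = σ ^ 2 • (W * Wᵀ) := by
    have : W * Wᵀ = W * Ldᵀ := by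
      conv_lhs => rw [hW, transpose_sub, transpose_mul, Matrix.mul_sub, ← hW, ← Matrix.mul_assoc,
        hWa, Matrix.zero_mul, sub_zero]
    rw [this, h11, h21, Matrix.mul_smul, ← smul_sub, hW, Matrix.sub_mul, Matrix.mul_assoc]
  rw [hWW]
  -- the regression error, as a function of the noise
  let w : (JointQuad N M → ℝ) → ℝ := fun x => x (Sum.inl i) - (K *ᵥ ancillaPart x) i
  have hwm : Measurable w := by
    have := (measurable_pi_apply i).comp ((measurable_mulVec K).comp
      (measurable_ancillaPart (N := N) (M := M)))
    exact (measurable_pi_apply _).sub this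
  have hanc : ∀ ξ, ancillaPart (S⁻¹ *ᵥ ξ) = La *ᵥ ξ := fun ξ => rfl
  have hwξ : ∀ ξ, w (S⁻¹ *ᵥ ξ) = W i ⬝ᵥ ξ := fun ξ => by
    change (S⁻¹ *ᵥ ξ) (Sum.inl i) - (K *ᵥ ancillaPart (S⁻¹ *ᵥ ξ)) i = (W *ᵥ ξ) i
    rw [hanc, hW, Matrix.sub_mulVec, ← Matrix.mulVec_mulVec]
    rfl
  have hfst := measurePreserving_fst_noiseSyndromeLaw S σ κ
  have hw2 : MemLp (fun z : (JointQuad N M → ℝ) × Y => w z.1) 2 ρ := by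
    refine (MemLp.comp_measurePreserving (g := w) ?_ hfst)
    rw [decodedNoise, memLp_map_measure_iff hwm.aestronglyMeasurable
      (measurable_mulVec _).aemeasurable]
    exact ((hasGaussianLaw_dotProduct_pi_gaussianReal v (W i)).memLp_two).congr_norm
      (hwm.comp (measurable_mulVec _)).aestronglyMeasurable (by simp [hwξ])
  have hwsq : ∫ z, w z.1 ^ 2 ∂ρ = (σ ^ 2 • (W * Wᵀ)) i i := by
    have h1 : ∫ z, w z.1 ^ 2 ∂ρ = ∫ x, w x ^ 2 ∂(decodedNoise S σ) := by
      rw [← hfst.map_eq, integral_map measurable_fst.aemeasurable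
        (hwm.pow_const 2).aestronglyMeasurable]
    rw [h1, decodedNoise, integral_map (measurable_mulVec _).aemeasurable
      (hwm.pow_const 2).aestronglyMeasurable]
    simp only [hwξ, pow_two (_ ⬝ᵥ _)]
    rw [agn, integral_dotProduct_mul_pi_gaussianReal, hvσ]
    rfl
  have hrm : Measurable fun z : (JointQuad N M → ℝ) × Y => residual f z i := by
    unfold residual; fun_prop
  have hr2 : MemLp (fun z => residual f z i) 2 ρ :=
    (memLp_two_iff_integrable_sq hrm.aestronglyMeasurable).2 hint
  -- The residual is `w + h`, where `h` depends only on the ancilla noise and the syndrome.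
  let h : (Quad M → ℝ) × Y → ℝ := fun y => (K *ᵥ y.1) i - f y.2 i
  have hhm : Measurable h := by
    have : Measurable fun y : (Quad M → ℝ) × Y => (K *ᵥ y.1) i :=
      (measurable_pi_apply i).comp ((measurable_mulVec K).comp measurable_fst)
    exact this.sub ((measurable_pi_apply i).comp (hf.comp measurable_snd))
  have hdecomp : ∀ z, residual f z i = w z.1 + h (ancillaPart z.1, z.2) := fun z => by
    simp only [residual, w, h]; ring
  -- Nothing is assumed on the moments of `f`; `h` is square integrable as the difference of the
  -- residual and `w`.
  have hh2 : MemLp (fun z : (JointQuad N M → ℝ) × Y => h (ancillaPart z.1, z.2)) 2 ρ := by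
    have := hr2.sub hw2
    refine this.ae_eq (Filter.Eventually.of_forall fun z => ?_)
    simp [hdecomp]
  have hwh : Integrable (fun z => w z.1 * h (ancillaPart z.1, z.2)) ρ := hw2.integrable_mul hh2
  -- Integrating out the syndrome first turns `h` into a function of `x_a` alone, since the kernel
  -- only sees `x_a`; this is independent of the centred `w`.
  have hcross : ∫ z, w z.1 * h (ancillaPart z.1, z.2) ∂ρ = 0 := by
    have hHm : StronglyMeasurable fun y => ∫ s, h (y, s) ∂(κ y) :=
      hhm.stronglyMeasurable.integral_kernel_prod_right'
    rw [hρ, noiseSyndromeLaw] at hwh ⊢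
    rw [Measure.integral_compProd hwh]
    simp only [integral_const_mul, Kernel.comap_apply]
    have hwH : Measurable fun x => w x * ∫ s, h (ancillaPart x, s) ∂(κ (ancillaPart x)) :=
      hwm.mul (hHm.measurable.comp measurable_ancillaPart)
    rw [decodedNoise, integral_map (measurable_mulVec _).aemeasurable hwH.aestronglyMeasurable]
    simp only [hwξ, hanc]
    have hI := (indepFun_dotProduct_mulVec_pi_gaussianReal v (W i) La
      fun j => congrFun (congrFun hWa i) j).comp measurable_id hHm.measurable
    have := hI.integral_fun_mul_eq_mul_integral
      (hasGaussianLaw_dotProduct_pi_gaussianReal v (W i)).aemeasurable.aestronglyMeasurable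
      (hHm.measurable.comp (measurable_mulVec La)).aestronglyMeasurable
    simp only [Function.comp_def, id] at this
    rw [agn, this, integral_dotProduct_pi_gaussianReal, zero_mul]
  have hexp : ∫ z, residual f z i ^ 2 ∂ρ = ∫ z, w z.1 ^ 2 ∂ρ +
      2 * ∫ z, w z.1 * h (ancillaPart z.1, z.2) ∂ρ + ∫ z, h (ancillaPart z.1, z.2) ^ 2 ∂ρ := by
    have hsum : Integrable (fun z => w z.1 ^ 2 + 2 * (w z.1 * h (ancillaPart z.1, z.2))) ρ :=
      hw2.integrable_sq.add (hwh.const_mul 2)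
    rw [← integral_const_mul, ← integral_add hw2.integrable_sq (hwh.const_mul 2),
      ← integral_add hsum hh2.integrable_sq]
    congr 1; ext z
    rw [hdecomp]; ring
  rw [hexp, hcross, hwsq]
  have : 0 ≤ ∫ z, h (ancillaPart z.1, z.2) ^ 2 ∂ρ := integral_nonneg fun z => sq_nonneg _
  linarith

theorem le_rmsErrorSq_of_regression (S : Matrix (JointQuad N M) (JointQuad N M) ℝ) {σ : ℝ}
    (hσ : 0 < σ) (K : Matrix (Quad N) (Quad M) ℝ)
    (hK : (noiseCov S σ).toBlocks₁₂ = K * (noiseCov S σ).toBlocks₂₂)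
    (κ : Kernel (Quad M → ℝ) Y) [IsMarkovKernel κ] (f : Y → Quad N → ℝ) (hf : Measurable f) :
    ENNReal.ofReal (((noiseCov S σ).toBlocks₁₁ - K * (noiseCov S σ).toBlocks₂₁).trace / (2 * N)) ≤
      rmsErrorSq S σ κ f := by
  unfold rmsErrorSq
  split_ifs with h
  · apply ENNReal.ofReal_le_ofReal
    gcongr
    refine Finset.sum_le_sum fun i _ => ?_
    have := integral_residual_sq_ge S hσ K hK κ f hf i (h i)
    simpa only [diag_apply, outputCov, of_apply, ← pow_two] using this
  · exact le_top

end Estimation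
-- Symplectic matrices and the trace inequality
section Symplectic

/-- The hypotheses make `-(J Sᵀ J)` a right inverse of `S`, hence also a left inverse; multiplying
that identity by `J` gives the claim. -/
theorem transpose_mul_mul_of_sq_eq_neg_one {ι : Type*} [Fintype ι] [DecidableEq ι]
    {J S : Matrix ι ι ℝ} (hJ : J * J = -1) (hS : S * J * Sᵀ = J) : Sᵀ * J * S = J := by
  have h1 : S * (-(J * Sᵀ * J)) = 1 := by
    rw [Matrix.mul_neg, ← Matrix.mul_assoc, ← Matrix.mul_assoc, hS, hJ, neg_neg]
  have h2 := mul_eq_one_comm.1 h1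
  have h3 : J * (J * Sᵀ * J * S) = -J := by
    rw [Matrix.neg_mul] at h2
    rw [← neg_eq_iff_eq_neg.2 h2.symm]; simp
  have h4 : J * (J * Sᵀ * J * S) = -(Sᵀ * J * S) := by
    rw [Matrix.mul_assoc, Matrix.mul_assoc, ← Matrix.mul_assoc J J, hJ, Matrix.mul_assoc]; simp
  rw [h4] at h3
  exact neg_injective h3

theorem isUnit_det_of_sq_eq_neg_one {ι : Type*} [Fintype ι] [DecidableEq ι]
    {J S : Matrix ι ι ℝ} (hJ : J * J = -1) (hS : S * J * Sᵀ = J) : IsUnit S.det := by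
  rw [← Matrix.isUnit_iff_isUnit_det]
  refine IsUnit.of_mul_eq_one (-(J * Sᵀ * J)) ?_
  rw [Matrix.mul_neg, ← Matrix.mul_assoc, ← Matrix.mul_assoc, hS, hJ, neg_neg]

theorem inv_mul_mul_inv_transpose {ι : Type*} [Fintype ι] [DecidableEq ι]
    {J S : Matrix ι ι ℝ} (hJ : J * J = -1) (hS : S * J * Sᵀ = J) : S⁻¹ * J * (S⁻¹)ᵀ = J := by
  have hu := isUnit_det_of_sq_eq_neg_one hJ hS
  conv_lhs => rw [← hS]
  rw [transpose_nonsing_inv, ← Matrix.mul_assoc, ← Matrix.mul_assoc, nonsing_inv_mul _ hu,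
    Matrix.one_mul, Matrix.mul_assoc, mul_nonsing_inv _ (by rwa [det_transpose]), Matrix.mul_one]

theorem symplForm_mul_self (n : ℕ) : symplForm n * symplForm n = -1 := by
  have : (!![0, 1; -1, 0] : Matrix (Fin 2) (Fin 2) ℝ) * !![0, 1; -1, 0] = (-1 : ℝ) • 1 := by
    ext i j; fin_cases i <;> fin_cases j <;> simp
  rw [symplForm, ← mul_kronecker_mul, this, Matrix.mul_one, kronecker_smul, one_kronecker_one]
  simp

theorem jointSymplForm_mul_self (N M : ℕ) : jointSymplForm N M * jointSymplForm N M = -1 := by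
  rw [jointSymplForm, fromBlocks_multiply]
  simp only [symplForm_mul_self, Matrix.mul_zero, Matrix.zero_mul, add_zero, zero_add]
  rw [← fromBlocks_one, fromBlocks_neg]; simp

theorem symplForm_transpose (n : ℕ) : (symplForm n)ᵀ = -symplForm n := by
  have : (!![0, 1; -1, 0] : Matrix (Fin 2) (Fin 2) ℝ)ᵀ = (-1 : ℝ) • !![0, 1; -1, 0] := by
    ext i j; fin_cases i <;> fin_cases j <;> simp
  rw [symplForm, ← kroneckerMap_transpose, this, transpose_one, kronecker_smul, neg_one_smul]

/-- A symplectic congruence does not decrease the trace below its value at the identity, on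
diagonal matrices with equal entries in both quadratures of each mode. -/
theorem two_mul_sum_le_trace {n : ℕ} {A : Matrix (Quad n) (Quad n) ℝ}
    (hA : Aᵀ * symplForm n * A = symplForm n) (d : Fin n → ℝ) (hd : ∀ i, 0 ≤ d i) :
    2 * ∑ i, d i ≤ (A * (diagonal d ⊗ₖ (1 : Matrix (Fin 2) (Fin 2) ℝ)) * Aᵀ).trace := by
  -- The two columns of `A` belonging to mode `k` have symplectic product `1`, so by `2ab ≤ a² + b²`
  -- their squared norms add up to at least `2`.
  have hcol : ∀ k : Fin n, ∑ m : Fin n, (A (m, 0) (k, 0) * A (m, 1) (k, 1)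
      - A (m, 1) (k, 0) * A (m, 0) (k, 1)) = 1 := fun k => by
    have := congrFun (congrFun hA (k, 0)) (k, 1)
    simp only [symplForm, Matrix.mul_apply, kroneckerMap_apply, transpose_apply,
      Fintype.sum_prod_type, Fin.sum_univ_two, Matrix.one_apply] at this
    simp [Finset.sum_add_distrib] at this
    rw [Finset.sum_sub_distrib]
    simp only [mul_comm] at this ⊢
    linarith
  have htr : (A * (diagonal d ⊗ₖ (1 : Matrix (Fin 2) (Fin 2) ℝ)) * Aᵀ).trace =
      ∑ k, d k * ∑ m : Fin n, (A (m, 0) (k, 0) ^ 2 + A (m, 1) (k, 1) ^ 2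
        + A (m, 1) (k, 0) ^ 2 + A (m, 0) (k, 1) ^ 2) := by
    have hdiag : ∀ a, (A * (diagonal d ⊗ₖ (1 : Matrix (Fin 2) (Fin 2) ℝ)) * Aᵀ) a a =
        ∑ k, A a k * d k.1 * A a k := fun a => by
      rw [← diagonal_one, diagonal_kronecker_diagonal, Matrix.mul_apply]
      simp only [mul_diagonal, transpose_apply, mul_one]
    simp only [Matrix.trace, diag_apply, hdiag, Fintype.sum_prod_type, Fin.sum_univ_two]
    simp only [← Finset.sum_add_distrib, Finset.mul_sum]
    rw [Finset.sum_comm]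
    refine Finset.sum_congr rfl fun k _ => Finset.sum_congr rfl fun m _ => ?_
    ring
  rw [htr, Finset.mul_sum]
  refine Finset.sum_le_sum fun k _ => ?_
  rw [mul_comm 2]
  refine mul_le_mul_of_nonneg_left ?_ (hd k)
  rw [← mul_one 2, ← hcol k, Finset.mul_sum]
  refine Finset.sum_le_sum fun m _ => ?_
  nlinarith [sq_nonneg (A (m, 0) (k, 0) - A (m, 1) (k, 1)),
    sq_nonneg (A (m, 1) (k, 0) + A (m, 0) (k, 1))]

end Symplectic

/-! ### Two-mode squeezed covariances and the error bound -/

section NormalForm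

theorem kronecker_sub_left {l m n p : Type*} (A B : Matrix l m ℝ) (C : Matrix n p ℝ) :
    (A - B) ⊗ₖ C = A ⊗ₖ C - B ⊗ₖ C := by
  ext i j; simp [sub_mul]

variable {N M : ℕ}

/-- The matrix with entries `a i` at `(i, i)`, for `i < min N M`, and zero elsewhere. -/
def pairing (M : ℕ) (a : Fin N → ℝ) : Matrix (Fin N) (Fin M) ℝ :=
  Matrix.of fun i j => if (i : ℕ) = (j : ℕ) then a i else 0

/-- The data coefficients `d`, moved to the ancilla modes of the same index; `1` elsewhere. -/
def partner (M : ℕ) (d : Fin N → ℝ) (j : Fin M) : ℝ := if h : (j : ℕ) < N then d ⟨j, h⟩ else 1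

theorem pairing_mul_transpose (a b : Fin N → ℝ) :
    pairing M a * (pairing M b)ᵀ = diagonal fun i : Fin N => if (i : ℕ) < M then a i * b i else 0 := by
  ext i k
  simp only [Matrix.mul_apply, pairing, of_apply, transpose_apply, diagonal_apply]
  split_ifs with hik hM
  · subst hik
    rw [Finset.sum_eq_single ⟨i, hM⟩]
    · simp
    · intro j _ hj
      rw [if_neg (fun h => hj (Fin.ext h.symm)), zero_mul]
    · simp
  · subst hik
    refine Finset.sum_eq_zero fun j _ => ?_
    rw [if_neg (by omega), zero_mul]
  · refine Finset.sum_eq_zero fun j _ => ?_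
    by_cases h : (i : ℕ) = j
    · rw [if_neg (c := (k : ℕ) = j) (fun h' => hik (Fin.ext (h.trans h'.symm))), mul_zero]
    · rw [if_neg h, zero_mul]

theorem transpose_pairing_mul (a b : Fin N → ℝ) :
    (pairing M a)ᵀ * pairing M b =
      diagonal fun j : Fin M => if h : (j : ℕ) < N then a ⟨j, h⟩ * b ⟨j, h⟩ else 0 := by
  ext i k
  simp only [Matrix.mul_apply, pairing, of_apply, transpose_apply, diagonal_apply]
  split_ifs with hik hM
  · subst hik
    rw [Finset.sum_eq_single ⟨i, hM⟩]
    · simp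
    · intro j _ hj
      rw [if_neg (fun h => hj (Fin.ext h)), zero_mul]
    · simp
  · subst hik
    refine Finset.sum_eq_zero fun j _ => ?_
    rw [if_neg (by omega), zero_mul]
  · refine Finset.sum_eq_zero fun j _ => ?_
    by_cases h : (j : ℕ) = i
    · rw [if_neg (fun h' => hik (Fin.ext (h.symm.trans h'))), mul_zero]
    · rw [if_neg h, zero_mul]

theorem diagonal_mul_pairing (d a : Fin N → ℝ) :
    diagonal d * pairing M a = pairing M fun i => d i * a i := by
  ext i j; simp [pairing, diagonal_mul]

theorem pairing_mul_diagonal_partner (a d : Fin N → ℝ) :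
    pairing M a * diagonal (partner M d) = pairing M fun i => a i * d i := by
  ext i j
  simp only [mul_diagonal, pairing, of_apply, partner]
  by_cases h : (i : ℕ) = j
  · have hj : (j : ℕ) < N := h ▸ i.2
    rw [if_pos h, if_pos h, dif_pos hj, show (⟨j, hj⟩ : Fin N) = i from Fin.ext h.symm]
  · rw [if_neg h, if_neg h, zero_mul]

theorem pairing_add (a b : Fin N → ℝ) :
    pairing M a + pairing M b = pairing M fun i => a i + b i := by
  ext i j; simp only [pairing, Matrix.add_apply, of_apply]; split_ifs <;> simp

/-- The covariance matrix of a product of two-mode squeezed states with symplectic eigenvalues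
`ν i` of the data modes. -/
noncomputable def squeezedCov (M : ℕ) (ν : Fin N → ℝ) : Matrix (JointQuad N M) (JointQuad N M) ℝ :=
  fromBlocks (diagonal ν ⊗ₖ (1 : Matrix (Fin 2) (Fin 2) ℝ))
    (pairing M (fun i => √(ν i ^ 2 - 1)) ⊗ₖ pauliZ)
    ((pairing M fun i => √(ν i ^ 2 - 1))ᵀ ⊗ₖ pauliZ)
    (diagonal (partner M ν) ⊗ₖ (1 : Matrix (Fin 2) (Fin 2) ℝ))

theorem pauliZ_mul_self : pauliZ * pauliZ = 1 := by
  ext i j; fin_cases i <;> fin_cases j <;> simp [pauliZ]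

theorem pauliZ_transpose : pauliZᵀ = pauliZ := by
  ext i j; fin_cases i <;> fin_cases j <;> simp [pauliZ]

/-- These are the hyperbolic double-angle formulas: for `√G = cosh r` and `√(G - 1) = sinh r`, the
entries become `cosh 2r = 2G - 1` and `sinh 2r`. A data mode without partner receives no `sinh²`
term, which is why `G i = 1` is needed there. -/
theorem tmsProduct_mul_transpose (G : Fin N → ℝ) (hG : ∀ i, 1 ≤ G i)
    (hM : ∀ i : Fin N, M ≤ (i : ℕ) → G i = 1) :
    tmsProduct (M := M) G * (tmsProduct (M := M) G)ᵀ = squeezedCov M fun i => 2 * G i - 1 := by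
  have hT : tmsProduct (M := M) G =
      fromBlocks (diagonal (fun i => √(G i)) ⊗ₖ (1 : Matrix (Fin 2) (Fin 2) ℝ))
        (pairing M (fun i => √(G i - 1)) ⊗ₖ pauliZ) ((pairing M fun i => √(G i - 1))ᵀ ⊗ₖ pauliZ)
        (diagonal (partner M fun i => √(G i)) ⊗ₖ (1 : Matrix (Fin 2) (Fin 2) ℝ)) := rfl
  have hs : ∀ i, √(G i) * √(G i - 1) + √(G i - 1) * √(G i) = √((2 * G i - 1) ^ 2 - 1) := fun i => by
    have h := hG i
    rw [show (2 * G i - 1) ^ 2 - 1 = 2 ^ 2 * (G i * (G i - 1)) by ring,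
      Real.sqrt_mul (by norm_num), Real.sqrt_sq (by norm_num), Real.sqrt_mul (by linarith)]
    ring
  have h12 : diagonal (fun i => √(G i)) * pairing M (fun i => √(G i - 1)) +
      pairing M (fun i => √(G i - 1)) * diagonal (partner M fun i => √(G i)) =
      pairing M fun i => √((2 * G i - 1) ^ 2 - 1) := by
    rw [diagonal_mul_pairing, pairing_mul_diagonal_partner, pairing_add]
    simp only [hs]
  rw [hT, fromBlocks_transpose, fromBlocks_multiply, squeezedCov]
  simp only [← kroneckerMap_transpose, transpose_one, diagonal_transpose, pauliZ_transpose,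
    transpose_transpose, ← mul_kronecker_mul, Matrix.one_mul, Matrix.mul_one, pauliZ_mul_self,
    ← add_kronecker]
  congr 2
  · rw [diagonal_mul_diagonal, pairing_mul_transpose, diagonal_add]
    congr 1; ext i
    have h := hG i
    rw [Real.mul_self_sqrt (by linarith), Real.mul_self_sqrt (by linarith)]
    split_ifs with hi
    · ring
    · rw [hM i (by omega)]; ring
  · rw [← h12, transpose_add, transpose_mul, transpose_mul, diagonal_transpose,
      diagonal_transpose]
  · rw [diagonal_mul_diagonal, transpose_pairing_mul, diagonal_add]
    congr 1; ext j
    simp only [partner]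
    split_ifs with hj
    · have h := hG ⟨j, hj⟩
      rw [Real.mul_self_sqrt (by linarith), Real.mul_self_sqrt (by linarith)]
      ring
    · simp

/-- The linear regression of the data quadratures on the ancilla quadratures of a product of
two-mode squeezed states. -/
theorem squeezedCov_regression (ν : Fin N → ℝ) (hν : ∀ i, 1 ≤ ν i)
    (hM : ∀ i : Fin N, M ≤ (i : ℕ) → ν i = 1) :
    ∃ K : Matrix (Quad N) (Quad M) ℝ,
      (squeezedCov M ν).toBlocks₁₂ = K * (squeezedCov M ν).toBlocks₂₂ ∧
      (squeezedCov M ν).toBlocks₁₁ - K * (squeezedCov M ν).toBlocks₂₁ =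
        diagonal (fun i => (ν i)⁻¹) ⊗ₖ (1 : Matrix (Fin 2) (Fin 2) ℝ) := by
  have hpos : ∀ i, 0 < ν i := fun i => by linarith [hν i]
  -- The coefficient is covariance over variance, and the error left is `ν - (ν² - 1) / ν = ν⁻¹`.
  refine ⟨pairing M (fun i => √(ν i ^ 2 - 1) / ν i) ⊗ₖ pauliZ, ?_, ?_⟩
  · simp only [squeezedCov, toBlocks_fromBlocks₁₂, toBlocks_fromBlocks₂₂]
    rw [← mul_kronecker_mul, pairing_mul_diagonal_partner, Matrix.mul_one]
    congr 2; ext i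
    rw [div_mul_cancel₀ _ (hpos i).ne']
  · simp only [squeezedCov, toBlocks_fromBlocks₁₁, toBlocks_fromBlocks₂₁]
    rw [← mul_kronecker_mul, pauliZ_mul_self, pairing_mul_transpose, ← kronecker_sub_left,
      diagonal_sub]
    congr 2; ext i
    have h := hν i
    have h0 := hpos i
    split_ifs with hi
    · rw [div_mul_eq_mul_div, Real.mul_self_sqrt (by nlinarith)]
      field_simp
      ring
    · rw [hM i (by omega)]; simp

/-- The bound on the RMS error, in terms of the gains. -/
theorem le_rmsErrorSq_of_isReductionGains {Y : Type*} [MeasurableSpace Y] {σ : ℝ} (hσ : 0 < σ)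
    {S : Matrix (JointQuad N M) (JointQuad N M) ℝ} {G : Fin N → ℝ} (hG : IsReductionGains S σ G)
    (κ : Kernel (Quad M → ℝ) Y) [IsMarkovKernel κ] (f : Y → Quad N → ℝ) (hf : Measurable f) :
    ENNReal.ofReal ((1 / (N : ℝ)) * ∑ i, σ ^ 2 / (2 * G i - 1)) ≤ rmsErrorSq S σ κ f := by
  obtain ⟨hG1, hGM, A, B, hA, hB, hAB⟩ := hG
  rw [tmsProduct_mul_transpose G hG1 hGM] at hAB
  obtain ⟨K, hK, hKD⟩ := squeezedCov_regression (M := M) (fun i => 2 * G i - 1)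
    (fun i => by linarith [hG1 i]) (fun i hi => by rw [hGM i hi]; norm_num)
  set C := squeezedCov M fun i => 2 * G i - 1
  set V := noiseCov S σ
  have hAu := isUnit_det_of_sq_eq_neg_one (symplForm_mul_self N) hA
  have hBu := isUnit_det_of_sq_eq_neg_one (symplForm_mul_self M) hB
  rw [← fromBlocks_toBlocks V, ← fromBlocks_toBlocks C, fromBlocks_transpose, fromBlocks_multiply,
    fromBlocks_multiply, fromBlocks_smul] at hAB
  simp only [Matrix.zero_mul, Matrix.mul_zero, add_zero, zero_add, transpose_zero] at hAB
  obtain ⟨h11, h12, h21, h22⟩ := fromBlocks_inj.1 hAB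
  have hATu : IsUnit Aᵀ.det := by rwa [det_transpose]
  have hBTu : IsUnit Bᵀ.det := by rwa [det_transpose]
  -- Regression is equivariant under local changes of coordinates: `K` becomes `A⁻¹ K B`, and `B`
  -- drops out of the Schur complement.
  have hKV : V.toBlocks₁₂ = A⁻¹ * K * B * V.toBlocks₂₂ := by
    have : A * V.toBlocks₁₂ * Bᵀ = K * B * V.toBlocks₂₂ * Bᵀ := by
      rw [h12, hK, ← Matrix.mul_smul, ← h22]; simp only [Matrix.mul_assoc]
    have := congrArg (fun X => A⁻¹ * (X * (Bᵀ)⁻¹)) this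
    simp only [mul_nonsing_inv_cancel_right _ _ hBTu] at this
    rw [nonsing_inv_mul_cancel_left _ _ hAu] at this
    simpa only [Matrix.mul_assoc] using this
  have hcond : V.toBlocks₁₁ - A⁻¹ * K * B * V.toBlocks₂₁ = A⁻¹ *
      (diagonal (fun i => σ ^ 2 / (2 * G i - 1)) ⊗ₖ (1 : Matrix (Fin 2) (Fin 2) ℝ)) * (A⁻¹)ᵀ := by
    have hd : (diagonal (fun i => σ ^ 2 / (2 * G i - 1)) ⊗ₖ (1 : Matrix (Fin 2) (Fin 2) ℝ)) =
        σ ^ 2 • (C.toBlocks₁₁ - K * C.toBlocks₂₁) := by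
      rw [hKD, ← smul_kronecker, ← diagonal_smul]
      rfl
    rw [hd, smul_sub, ← Matrix.mul_smul K, ← h11, ← h21]
    rw [transpose_nonsing_inv]
    simp only [Matrix.mul_sub, Matrix.sub_mul, Matrix.mul_assoc, mul_nonsing_inv _ hATu,
      Matrix.mul_one, nonsing_inv_mul_cancel_left _ _ hAu]
  refine le_trans (ENNReal.ofReal_le_ofReal ?_) (le_rmsErrorSq_of_regression S hσ _ hKV κ f hf)
  rw [hcond]
  have hA' := transpose_mul_mul_of_sq_eq_neg_one (symplForm_mul_self N)
    (inv_mul_mul_inv_transpose (symplForm_mul_self N) hA)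
  have := two_mul_sum_le_trace hA' (fun i => σ ^ 2 / (2 * G i - 1))
    (fun i => div_nonneg (sq_nonneg σ) (by linarith [hG1 i]))
  rw [one_div_mul_eq_div, ← mul_div_mul_left _ (N : ℝ) two_ne_zero]
  gcongr

/-- Convexity of the noise in the gain: the average noise is at least that of the average gain. -/
theorem le_average_of_average_gain_le (hN : 0 < N) {σ Γ : ℝ} (hσ : 0 < σ) {G : Fin N → ℝ}
    (hG : ∀ i, 1 ≤ G i) (hΓ : (1 / (N : ℝ)) * ∑ i, G i ≤ Γ) :
    0 < σ ^ 2 / (2 * Γ - 1) ∧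
      σ ^ 2 / (2 * Γ - 1) ≤ (1 / (N : ℝ)) * ∑ i, σ ^ 2 / (2 * G i - 1) := by
  have hN' : (0 : ℝ) < N := by exact_mod_cast hN
  rw [one_div_mul_eq_div, div_le_iff₀ hN'] at hΓ
  have hsum : (N : ℝ) ≤ ∑ i, G i := by
    simpa using Finset.sum_le_sum fun i (_ : i ∈ Finset.univ) => hG i
  have hΓ1 : 1 ≤ Γ := by
    by_contra! h
    nlinarith
  set m := 2 * Γ - 1 with hm
  have hm0 : 0 < m := by linarith
  refine ⟨by positivity, ?_⟩
  -- The tangent line of `1 / y` at `y = m`, evaluated at `y = 2 G i - 1`. Its slope is negative, so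
  -- an average of `y` at most `m` suffices below.
  have htan : ∀ i, σ ^ 2 * (2 / m - (2 * G i - 1) / m ^ 2) ≤ σ ^ 2 / (2 * G i - 1) := fun i => by
    have h0 : 0 < 2 * G i - 1 := by linarith [hG i]
    rw [div_eq_mul_inv (σ ^ 2)]
    gcongr
    rw [← sub_nonneg]
    have : (2 * G i - 1)⁻¹ - (2 / m - (2 * G i - 1) / m ^ 2) =
        (m - (2 * G i - 1)) ^ 2 / (m ^ 2 * (2 * G i - 1)) := by
      field_simp; ring
    rw [this]; positivity
  rw [one_div_mul_eq_div, le_div_iff₀ hN']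
  refine le_trans ?_ (Finset.sum_le_sum fun i _ => htan i)
  rw [← Finset.mul_sum, Finset.sum_sub_distrib, ← Finset.sum_div _ _ (m ^ 2),
    Finset.sum_sub_distrib, ← Finset.mul_sum]
  simp only [Finset.sum_const, Finset.card_univ, Fintype.card_fin, nsmul_eq_mul, mul_one]
  rw [div_mul_eq_mul_div, mul_div_assoc]
  gcongr
  have h1 : (2 * ∑ i, G i - N) / m ^ 2 ≤ N * m / m ^ 2 := by
    gcongr
    rw [hm]; linarith
  have h2 : N * m / m ^ 2 = N / m := by field_simp
  have h3 : N * (2 / m) = N / m + N / m := by ring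
  linarith

end NormalForm
-- Counting and rescaling normal pairs
section Normal

variable {X ι : Type*} [AddCommGroup X] [Module ℝ X] {ω g : LinearMap.BilinForm ℝ X}

theorem IsNormalFamily.comp_equiv {κ : Type*} [Fintype ι] [Fintype κ] {ν : ι → ℝ} {u v : ι → X}
    (h : IsNormalFamily ω g Finset.univ ν u v) (e : κ ≃ ι) :
    IsNormalFamily ω g Finset.univ (ν ∘ e) (u ∘ e) (v ∘ e) :=
  ⟨fun i _ => h.1 (e i) (Finset.mem_univ _), fun i _ j _ hij =>
    h.2 (e i) (Finset.mem_univ _) (e j) (Finset.mem_univ _) (e.injective.ne hij)⟩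

/-- Pairing a linear relation with the symplectic partner of a vector isolates that vector's
coefficient, so all vectors of the family are independent. This limits the number of squeezed modes
by the number of ancilla modes. -/
theorem IsNormalFamily.two_mul_card_le_finrank [FiniteDimensional ℝ X]
    (hω : ∀ x y, ω x y = -ω y x) {s : Finset ι} {ν : ι → ℝ} {u v : ι → X}
    (h : IsNormalFamily ω g s ν u v) : 2 * s.card ≤ Module.finrank ℝ X := by
  classical
  have hself : ∀ x, ω x x = 0 := fun x => by linarith [hω x x]
  have huv : ∀ i j : s, ω (u i) (v j) = if i = j then 1 else 0 := fun i j => by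
    split_ifs with hij
    · rw [hij]; exact (h.1 j j.2).1
    · exact (h.2 i i.2 j j.2 (fun h => hij (Subtype.ext h))).2.1
  have huu : ∀ i j : s, ω (u i) (u j) = 0 := fun i j => by
    by_cases hij : i = j
    · rw [hij, hself]
    · exact (h.2 i i.2 j j.2 (fun h => hij (Subtype.ext h))).1
  have hvv : ∀ i j : s, ω (v i) (v j) = 0 := fun i j => by
    by_cases hij : i = j
    · rw [hij, hself]
    · exact (h.2 i i.2 j j.2 (fun h => hij (Subtype.ext h))).2.2
  have hvu : ∀ i j : s, ω (v i) (u j) = if i = j then -1 else 0 := fun i j => by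
    rw [hω, huv]
    by_cases hij : i = j
    · simp [hij]
    · simp [hij, Ne.symm hij]
  have hli : LinearIndependent ℝ (Sum.elim (fun i : s => u i) (fun i : s => v i)) := by
    rw [Fintype.linearIndependent_iff]
    intro c hc
    simp only [Fintype.sum_sum_type, Sum.elim_inl, Sum.elim_inr] at hc
    rintro (k | k)
    · have := congrArg (fun x => ω x (v k)) hc
      simpa [huv, hvv] using this
    · have := congrArg (fun x => ω x (u k)) hc
      simpa [huu, hvu] using this
  have := hli.fintype_card_le_finrank
  simp only [Fintype.card_sum, Fintype.card_coe] at this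
  omega

/-- Vectors spanning invariant planes of `g` on which the symplectic form takes the values
`ν i ^ 2 - 1` can be rescaled to normal pairs, for the indices with `ν i ≠ 1`. -/
theorem isNormalFamily_rescale [Fintype ι] [DecidableEq ι] {ν : ι → ℝ} {r₀ r₁ : ι → X}
    (h₁ : ∀ i y, g y (r₁ i) = ν i * ω y (r₀ i)) (h₀ : ∀ i y, g y (r₀ i) = -ν i * ω y (r₁ i))
    (h₁₀ : ∀ i j, ω (r₁ i) (r₀ j) = if i = j then ν i ^ 2 - 1 else 0)
    (h₁₁ : ∀ i j, ω (r₁ i) (r₁ j) = 0) (h₀₀ : ∀ i j, ω (r₀ i) (r₀ j) = 0) :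
    IsNormalFamily ω g (Finset.univ.filter fun i => 1 < ν i) ν
      (fun i => (√(ν i ^ 2 - 1))⁻¹ • r₁ i) (fun i => (√(ν i ^ 2 - 1))⁻¹ • r₀ i) := by
  refine ⟨fun i hi => ⟨?_, fun x => ?_, fun x => ?_⟩, fun i _ j _ hij => ⟨?_, ?_, ?_⟩⟩
  · have hi : 1 < ν i := by simpa using hi
    have hs : 0 < ν i ^ 2 - 1 := by nlinarith
    have hs' := Real.sqrt_pos.2 hs
    simp only [map_smul, LinearMap.smul_apply, smul_eq_mul, h₁₀, if_true]
    rw [← mul_assoc, ← mul_inv, Real.mul_self_sqrt hs.le, inv_mul_cancel₀ hs.ne']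
  · simp only [map_smul, smul_eq_mul, h₁]; ring
  · simp only [map_smul, smul_eq_mul, h₀]; ring
  · simp [h₁₁]
  · simp [h₁₀, hij]
  · simp [h₀₀]

end Normal

/-! ### Translation between forms and matrices -/

section Matrices

/-- The bilinear form with Gram matrix `P`. -/
noncomputable def gramForm {ι : Type*} [Fintype ι] [DecidableEq ι] (P : Matrix ι ι ℝ) :
    LinearMap.BilinForm ℝ (ι → ℝ) :=
  Matrix.toLinearMap₂' ℝ P

theorem gramForm_apply {ι : Type*} [Fintype ι] [DecidableEq ι] (P : Matrix ι ι ℝ) (x y : ι → ℝ) :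
    gramForm P x y = x ⬝ᵥ P *ᵥ y :=
  Matrix.toLinearMap₂'_apply' P x y

theorem gramForm_swap {ι : Type*} [Fintype ι] [DecidableEq ι] (P : Matrix ι ι ℝ) (x y : ι → ℝ) :
    gramForm P x y = gramForm Pᵀ y x := by
  rw [gramForm_apply, gramForm_apply, mulVec_transpose, dotProduct_comm y, dotProduct_mulVec]

theorem mul_mul_transpose_apply_eq_gramForm {ι κ : Type*} [Fintype ι] [DecidableEq ι]
    (B : Matrix κ ι ℝ) (P : Matrix ι ι ℝ) (a b : κ) :
    (B * P * Bᵀ) a b = gramForm P (B a) (B b) := by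
  rw [gramForm_apply, dotProduct_mulVec]
  rfl

theorem gramForm_symplForm_swap {n : ℕ} (x y : Quad n → ℝ) :
    gramForm (symplForm n) x y = -gramForm (symplForm n) y x := by
  rw [gramForm_swap, symplForm_transpose, gramForm_apply, gramForm_apply, neg_mulVec,
    dotProduct_neg]

theorem eq_zero_of_gramForm_symplForm {n : ℕ} (x : Quad n → ℝ)
    (h : ∀ y, gramForm (symplForm n) x y = 0) : x = 0 := by
  have := h (-(symplForm n *ᵥ x))
  rw [gramForm_apply, mulVec_neg, mulVec_mulVec, symplForm_mul_self, neg_mulVec, one_mulVec,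
    neg_neg] at this
  exact dotProduct_self_eq_zero.1 this

theorem finrank_quad (n : ℕ) : Module.finrank ℝ (Quad n → ℝ) = 2 * Fintype.card (Fin n) := by
  simp [mul_comm]

/-- The matrix with rows `u 0, v 0, u 1, v 1, …`. -/
def pairRows {n : ℕ} (u v : Fin n → Quad n → ℝ) : Matrix (Quad n) (Quad n) ℝ :=
  Matrix.of fun a => ![u a.1, v a.1] a.2

theorem symplForm_apply {n : ℕ} (i j : Fin n) (a b : Fin 2) :
    symplForm n (i, a) (j, b) = if i = j then (!![0, 1; -1, 0] : Matrix _ _ ℝ) a b else 0 := by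
  simp [symplForm, Matrix.one_apply]

theorem IsNormalFamily.isSymplectic_pairRows {n : ℕ} {g : LinearMap.BilinForm ℝ (Quad n → ℝ)}
    {ν : Fin n → ℝ} {u v : Fin n → Quad n → ℝ}
    (h : IsNormalFamily (gramForm (symplForm n)) g Finset.univ ν u v) :
    IsSymplectic (pairRows u v) := by
  have hself : ∀ x, gramForm (symplForm n) x x = 0 := fun x => by
    linarith [gramForm_symplForm_swap x x]
  have h0 : ∀ i, pairRows u v (i, 0) = u i := fun _ => rfl
  have h1 : ∀ i, pairRows u v (i, 1) = v i := fun _ => rfl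
  ext ⟨i, a⟩ ⟨j, b⟩
  rw [mul_mul_transpose_apply_eq_gramForm, symplForm_apply]
  revert a b
  simp only [Fin.forall_fin_two, h0, h1]
  by_cases hij : i = j
  · subst hij
    have h2 := (h.1 i (Finset.mem_univ i)).1
    have h3 : gramForm (symplForm n) (v i) (u i) = -1 := by rw [gramForm_symplForm_swap, h2]
    simp [hself, h2, h3]
  · obtain ⟨h2, h3, h4⟩ := h.2 i (Finset.mem_univ i) j (Finset.mem_univ j) hij
    have h5 := (h.2 j (Finset.mem_univ j) i (Finset.mem_univ i) (Ne.symm hij)).2.1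
    have h6 : gramForm (symplForm n) (v i) (u j) = 0 := by rw [gramForm_symplForm_swap, h5, neg_zero]
    simp [hij, h2, h3, h4, h6]

/-- Normality turns each Gram entry of `P` into `±ν j` times a symplectic product of rows, known
because the rows form a symplectic matrix. -/
theorem IsNormalFamily.pairRows_mul_mul_transpose {n : ℕ} {P : Matrix (Quad n) (Quad n) ℝ}
    {ν : Fin n → ℝ} {u v : Fin n → Quad n → ℝ}
    (h : IsNormalFamily (gramForm (symplForm n)) (gramForm P) Finset.univ ν u v) :
    pairRows u v * P * (pairRows u v)ᵀ = diagonal ν ⊗ₖ (1 : Matrix (Fin 2) (Fin 2) ℝ) := by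
  have hS := h.isSymplectic_pairRows
  have hS' : ∀ a b, gramForm (symplForm n) (pairRows u v a) (pairRows u v b) = symplForm n a b :=
    fun a b => by rw [← mul_mul_transpose_apply_eq_gramForm, hS]
  ext a ⟨j, b⟩
  obtain ⟨-, h1, h2⟩ := h.1 j (Finset.mem_univ j)
  rw [mul_mul_transpose_apply_eq_gramForm]
  obtain ⟨i, a⟩ := a
  have e1 := h1 (pairRows u v (i, a))
  have e2 := h2 (pairRows u v (i, a))
  have f1 := hS' (i, a) (j, 1)
  have f2 := hS' (i, a) (j, 0)
  rw [symplForm_apply] at f1 f2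
  have g1 : pairRows u v (j, 1) = v j := rfl
  have g0 : pairRows u v (j, 0) = u j := rfl
  rw [g1] at f1
  rw [g0] at f2
  rw [f1] at e1
  rw [f2] at e2
  by_cases hij : i = j
  · subst hij
    fin_cases b
    · refine e1.trans ?_
      fin_cases a <;> simp
    · refine e2.trans ?_
      fin_cases a <;> simp
  · fin_cases b
    · refine e1.trans ?_
      simp [hij]
    · refine e2.trans ?_
      simp [hij]

/-- The identity `V J V = J` expresses purity. It survives symplectic congruence, so its block
equations are available after each reduction step. -/
theorem congr_mul_mul_congr {ι : Type*} [Fintype ι] [DecidableEq ι] {J V L : Matrix ι ι ℝ}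
    (hJ : J * J = -1) (hL : L * J * Lᵀ = J) (hV : V * J * V = J) :
    (L * V * Lᵀ) * J * (L * V * Lᵀ) = J := by
  have h := transpose_mul_mul_of_sq_eq_neg_one hJ hL
  calc (L * V * Lᵀ) * J * (L * V * Lᵀ) = L * (V * (Lᵀ * J * L) * V) * Lᵀ := by
        simp only [Matrix.mul_assoc]
    _ = J := by rw [h, hV, hL]

theorem isJointSymplectic_fromBlocks {N M : ℕ} {A : Matrix (Quad N) (Quad N) ℝ}
    {B : Matrix (Quad M) (Quad M) ℝ} (hA : IsSymplectic A) (hB : IsSymplectic B) :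
    IsJointSymplectic (fromBlocks A 0 0 B) := by
  unfold IsSymplectic at hA hB
  simp [IsJointSymplectic, jointSymplForm, fromBlocks_multiply, fromBlocks_transpose, hA, hB]

theorem isSymplectic_one (n : ℕ) : IsSymplectic (1 : Matrix (Quad n) (Quad n) ℝ) := by
  simp [IsSymplectic]

end Matrices
-- Modewise decomposition and existence of gains
section Reduction

variable {N M : ℕ}

theorem mul_symplForm_apply_zero {n : ℕ} {κ : Type*} (C : Matrix (Quad n) κ ℝ) (i : Fin n) :
    (symplForm n * C) (i, 0) = C (i, 1) := by
  ext k
  simp [Matrix.mul_apply, Fintype.sum_prod_type, symplForm_apply, Fin.sum_univ_two]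

theorem mul_symplForm_apply_one {n : ℕ} {κ : Type*} (C : Matrix (Quad n) κ ℝ) (i : Fin n) :
    (symplForm n * C) (i, 1) = -C (i, 0) := by
  ext k
  simp [Matrix.mul_apply, Fintype.sum_prod_type, symplForm_apply, Fin.sum_univ_two]

theorem diagonal_kronecker_one_mul_apply {n : ℕ} {κ : Type*} (d : Fin n → ℝ)
    (C : Matrix (Quad n) κ ℝ) (i : Fin n) (a : Fin 2) (k : κ) :
    ((diagonal d ⊗ₖ (1 : Matrix (Fin 2) (Fin 2) ℝ)) * C) (i, a) k = d i * C (i, a) k := by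
  rw [← diagonal_one, diagonal_kronecker_diagonal, diagonal_mul, mul_one]

/-- If the data block of a pure covariance matrix is in Williamson form, a symplectic matrix on the
ancilla modes brings the whole matrix to that of a product of two-mode squeezed states. -/
theorem exists_ancilla_reduction {ν : Fin N → ℝ} (hν : ∀ i, 0 < ν i) (hanti : Antitone ν)
    {C : Matrix (Quad N) (Quad M) ℝ} {Q : Matrix (Quad M) (Quad M) ℝ} (hQ : Qᵀ = Q)
    (hQpos : ∀ x, x ≠ 0 → 0 < gramForm Q x x)
    (hV : fromBlocks (diagonal ν ⊗ₖ (1 : Matrix (Fin 2) (Fin 2) ℝ)) C Cᵀ Q * jointSymplForm N M *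
      fromBlocks (diagonal ν ⊗ₖ (1 : Matrix (Fin 2) (Fin 2) ℝ)) C Cᵀ Q = jointSymplForm N M) :
    (∀ i, 1 ≤ ν i) ∧ (∀ i : Fin N, M ≤ (i : ℕ) → ν i = 1) ∧
    ∃ B : Matrix (Quad M) (Quad M) ℝ, IsSymplectic B ∧
      fromBlocks 1 0 0 B * fromBlocks (diagonal ν ⊗ₖ (1 : Matrix (Fin 2) (Fin 2) ℝ)) C Cᵀ Q *
        (fromBlocks 1 0 0 B)ᵀ = squeezedCov M ν := by
  set D := diagonal ν ⊗ₖ (1 : Matrix (Fin 2) (Fin 2) ℝ) with hD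
  have hV0 := hV
  rw [jointSymplForm, fromBlocks_multiply, fromBlocks_multiply] at hV
  simp only [Matrix.mul_zero, add_zero, zero_add] at hV
  obtain ⟨e11, e12, -, -⟩ := fromBlocks_inj.1 hV
  set ω := gramForm (symplForm M) with hω
  set g := gramForm Q with hg
  have hswap : ∀ x y, ω x y = -ω y x := gramForm_symplForm_swap
  -- the rows of `C * Ω`
  let r : Quad N → Quad M → ℝ := fun a => C a ᵥ* symplForm M
  have hr : ∀ a y, ω y (r a) = C a ⬝ᵥ y := fun a y => by
    rw [hω, gramForm_apply, ← vecMul_transpose, symplForm_transpose, vecMul_neg, vecMul_vecMul,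
      symplForm_mul_self, vecMul_neg, vecMul_one, neg_neg, dotProduct_comm]
  have hgr : ∀ a y, g y (r a) = (C * symplForm M * Q) a ⬝ᵥ y := fun a y => by
    rw [hg, gramForm_apply, dotProduct_comm, ← hQ, mulVec_transpose, hQ]
    rfl
  -- The data-ancilla block of `V Ω V = Ω`. It yields `h₁` and `h₀`: the rows `r (i, 1)`, `r (i, 0)`
  -- satisfy the equations of a normal pair with value `ν i`, up to scale.
  have hCQ : C * symplForm M * Q = -(D * (symplForm N * C)) := by
    rw [← Matrix.mul_assoc]
    exact eq_neg_of_add_eq_zero_right e12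
  have h₁ : ∀ i y, g y (r (i, 1)) = ν i * ω y (r (i, 0)) := fun i y => by
    have : (D * (symplForm N * C)) (i, 1) = -(ν i • C (i, 0)) := by
      ext k
      rw [hD, diagonal_kronecker_one_mul_apply, mul_symplForm_apply_one]; simp
    rw [hgr, hr, hCQ]
    change (-((D * (symplForm N * C)) (i, 1))) ⬝ᵥ y = _
    rw [this, neg_neg, smul_dotProduct, smul_eq_mul]
  have h₀ : ∀ i y, g y (r (i, 0)) = -ν i * ω y (r (i, 1)) := fun i y => by
    have : (D * (symplForm N * C)) (i, 0) = ν i • C (i, 1) := by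
      ext k
      rw [hD, diagonal_kronecker_one_mul_apply, mul_symplForm_apply_zero]; simp
    rw [hgr, hr, hCQ]
    change (-((D * (symplForm N * C)) (i, 0))) ⬝ᵥ y = _
    rw [this, neg_dotProduct, smul_dotProduct, smul_eq_mul, neg_mul]
  -- The data-data block of `V Ω V = Ω` gives the symplectic products of the rows.
  have hrr : ∀ i j a b, ω (r (i, a)) (r (j, b)) =
      if i = j then (1 - ν i ^ 2) * (!![0, 1; -1, 0] : Matrix (Fin 2) (Fin 2) ℝ) a b else 0 := by
    intro i j a b
    have e : C * symplForm M * Cᵀ = symplForm N - D * symplForm N * D :=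
      eq_sub_of_add_eq' e11
    have e' := congrFun (congrFun e (i, a)) (j, b)
    have hDD : (D * symplForm N * D) (i, a) (j, b) = ν i * symplForm N (i, a) (j, b) * ν j := by
      rw [hD, ← diagonal_one, diagonal_kronecker_diagonal, mul_diagonal, diagonal_mul]
      simp
    rw [Matrix.sub_apply, hDD, symplForm_apply] at e'
    rw [hr, dotProduct_comm]
    refine e'.trans ?_
    split_ifs with hij
    · rw [hij]; ring
    · ring
  have h₁₀ : ∀ i j, ω (r (i, 1)) (r (j, 0)) = if i = j then ν i ^ 2 - 1 else 0 := fun i j => by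
    rw [hrr]; split_ifs <;> simp
  have h₁₁ : ∀ i j, ω (r (i, 1)) (r (j, 1)) = 0 := fun i j => by
    rw [hrr]; simp
  have h₀₀ : ∀ i j, ω (r (i, 0)) (r (j, 0)) = 0 := fun i j => by
    rw [hrr]; simp
  have hg1 : ∀ i a, g (r (i, a)) (r (i, a)) = ν i * (ν i ^ 2 - 1) := by
    intro i
    rw [Fin.forall_fin_two]
    constructor
    · rw [h₀, hswap, h₁₀, if_pos rfl]; ring
    · rw [h₁, h₁₀, if_pos rfl]
  -- The value `g (r, r) = ν (ν² - 1)` cannot be negative, and `ν = 1` forces the row to vanish.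
  have hν1 : ∀ i, 1 ≤ ν i := fun i => by
    by_contra! hlt
    have hneg : ν i * (ν i ^ 2 - 1) < 0 :=
      mul_neg_of_pos_of_neg (hν i) (by nlinarith [hν i])
    have h := hg1 i 0
    by_cases h0 : r (i, 0) = 0
    · rw [h0] at h; simp at h; rcases h with h | h <;> nlinarith [hν i]
    · linarith [hQpos _ h0]
  have hr0 : ∀ i, ν i = 1 → ∀ a, r (i, a) = 0 := fun i hi a => by
    by_contra h0
    have := hQpos _ h0
    rw [hg1, hi] at this
    norm_num at this
  have hfam := isNormalFamily_rescale h₁ h₀ h₁₀ h₁₁ h₀₀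
  -- As `ν` is decreasing, `ν i > 1` would give `i + 1` normal pairs in dimension `2 M`, hence `i <
  -- M`.
  have hνM : ∀ i : Fin N, M ≤ (i : ℕ) → ν i = 1 := fun i hi => by
    by_contra hne
    have hgt : 1 < ν i := lt_of_le_of_ne (hν1 i) (Ne.symm hne)
    have hcard := hfam.two_mul_card_le_finrank hswap
    rw [finrank_quad, Fintype.card_fin] at hcard
    have hsub : Finset.Iic i ⊆ Finset.univ.filter fun i => 1 < ν i := fun k hk => by
      simp only [Finset.mem_filter, Finset.mem_univ, true_and]
      exact hgt.trans_le (hanti (Finset.mem_Iic.1 hk))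
    have := Finset.card_le_card hsub
    rw [Fin.card_Iic] at this
    omega
  refine ⟨hν1, hνM, ?_⟩
  -- the family of ancilla modes, indexed by the ancilla
  let s : Finset (Fin M) := Finset.univ.filter fun j => 1 < partner M ν j
  have hmem : ∀ j, j ∈ s ↔ 1 < partner M ν j := fun j => by simp [s]
  -- The default `0` is never met on `s`: for `j ≥ N` the default of `partner` is `1`, which
  -- excludes `j`.
  let onAncilla : (Fin N → Quad M → ℝ) → Fin M → Quad M → ℝ :=
    fun u j => if h : (j : ℕ) < N then u ⟨j, h⟩ else 0
  set u := fun i => (√(ν i ^ 2 - 1))⁻¹ • r (i, 1) with hu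
  set v := fun i => (√(ν i ^ 2 - 1))⁻¹ • r (i, 0) with hv
  have hs : ∀ j ∈ s, ∃ h : (j : ℕ) < N, 1 < ν ⟨j, h⟩ := fun j hj => by
    rw [hmem, partner] at hj
    split_ifs at hj with h
    · exact ⟨h, hj⟩
    · exact absurd hj (lt_irrefl 1)
  have hfamM : IsNormalFamily ω g s (partner M ν) (onAncilla u) (onAncilla v) := by
    constructor
    · intro j hj
      obtain ⟨h, h1⟩ := hs j hj
      simp only [onAncilla, partner, dif_pos h]
      exact hfam.1 ⟨j, h⟩ (by simpa using h1)
    · intro j hj k hk hjk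
      obtain ⟨h, h1⟩ := hs j hj
      obtain ⟨h', h1'⟩ := hs k hk
      simp only [onAncilla, dif_pos h, dif_pos h']
      exact hfam.2 ⟨j, h⟩ (by simpa using h1) ⟨k, h'⟩ (by simpa using h1')
        (fun e => hjk (Fin.ext (Fin.mk.inj e)))
  have hgsymm : ∀ x y, g x y = g y x := fun x y => by rw [hg, gramForm_swap, hQ]
  obtain ⟨μ, b₁, b₀, hb, hbs⟩ := hfamM.extend hswap eq_zero_of_gramForm_symplForm hgsymm hQpos
    (finrank_quad M)
  have hBs := hb.isSymplectic_pairRows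
  have hBQ := hb.pairRows_mul_mul_transpose
  have hB1 : ∀ i, pairRows b₁ b₀ (i, 0) = b₁ i := fun _ => rfl
  have hB0 : ∀ i, pairRows b₁ b₀ (i, 1) = b₀ i := fun _ => rfl
  set B := pairRows b₁ b₀ with hB
  have hBω : ∀ a b, ω (B a) (B b) = symplForm M a b :=
    fun a b => by rw [hω, ← mul_mul_transpose_apply_eq_gramForm, hBs]
  -- Each nonzero row `r` is a multiple of a row of the symplectic `B`, so the entries are
  -- symplectic products of rows of `B`. As `r (i, 1)` is the first vector of its pair, the signs
  -- form `Z`.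
  have hCB : C * Bᵀ = pairing M (fun i => √(ν i ^ 2 - 1)) ⊗ₖ pauliZ := by
    ext ⟨i, a⟩ ⟨j, b⟩
    have hentry : (C * Bᵀ) (i, a) (j, b) = ω (B (j, b)) (r (i, a)) := (hr _ _).symm
    rw [hentry, kroneckerMap_apply, pairing, of_apply]
    rcases (hν1 i).eq_or_lt with hi | hi
    · rw [hr0 i hi.symm, ← hi]; simp
    · have hiM : (i : ℕ) < M := by
        by_contra hle
        exact hi.ne' (hνM i (by omega))
      have hsq : 0 < √(ν i ^ 2 - 1) := Real.sqrt_pos.2 (by nlinarith)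
      have hk : (⟨i, hiM⟩ : Fin M) ∈ s := by
        rw [hmem, partner, dif_pos i.2]; exact hi
      obtain ⟨-, hk1, hk0⟩ := hbs _ hk
      simp only [onAncilla, Fin.is_lt, dif_pos, Fin.eta, hu, hv] at hk1 hk0
      have hr1 : r (i, 1) = √(ν i ^ 2 - 1) • B (⟨i, hiM⟩, 0) := by
        rw [hB1, hk1, smul_smul, mul_inv_cancel₀ hsq.ne', one_smul]
      have hr0 : r (i, 0) = √(ν i ^ 2 - 1) • B (⟨i, hiM⟩, 1) := by
        rw [hB0, hk0, smul_smul, mul_inv_cancel₀ hsq.ne', one_smul]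
      have hji : (j = ⟨i, hiM⟩) ↔ (i : ℕ) = j := by
        rw [Fin.ext_iff]; exact eq_comm
      revert a b
      simp only [Fin.forall_fin_two, hr1, hr0, map_smul, hBω, symplForm_apply, hji]
      by_cases h : (i : ℕ) = j <;> simp [h, pauliZ]
  refine ⟨B, hBs, ?_⟩
  have hL := isJointSymplectic_fromBlocks (isSymplectic_one N) hBs
  have hV2 := congr_mul_mul_congr (jointSymplForm_mul_self N M) hL hV0
  have hBC : B * Cᵀ = (pairing M (fun i => √(ν i ^ 2 - 1)))ᵀ ⊗ₖ pauliZ := by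
    rw [← transpose_transpose B, ← transpose_mul, hCB, ← kroneckerMap_transpose, pauliZ_transpose]
  have hblocks : fromBlocks 1 0 0 B * fromBlocks D C Cᵀ Q * (fromBlocks 1 0 0 B)ᵀ =
      fromBlocks D (pairing M (fun i => √(ν i ^ 2 - 1)) ⊗ₖ pauliZ)
        ((pairing M (fun i => √(ν i ^ 2 - 1)))ᵀ ⊗ₖ pauliZ)
        (diagonal μ ⊗ₖ (1 : Matrix (Fin 2) (Fin 2) ℝ)) := by
    rw [fromBlocks_transpose, fromBlocks_multiply, fromBlocks_multiply]
    simp [hCB, hBC, hBQ]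
  rw [hblocks] at hV2 ⊢
  rw [jointSymplForm, fromBlocks_multiply, fromBlocks_multiply] at hV2
  simp only [Matrix.mul_zero, add_zero, zero_add] at hV2
  obtain ⟨-, -, -, e22⟩ := fromBlocks_inj.1 hV2
  -- The ancilla-ancilla block of purity, with `Z Ω Z = -Ω`, reads `μ² - (ν² - 1) = 1` on partnered
  -- modes and `μ² = 1` elsewhere. This also determines the values added by the extension.
  have hμ : μ = partner M ν := by
    funext j
    have hμ0 : 0 < μ j := (hb.1 j (Finset.mem_univ j)).pos hQpos
    simp only [symplForm, ← mul_kronecker_mul, Matrix.mul_one, Matrix.one_mul,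
      transpose_pairing_mul, diagonal_mul_diagonal] at e22
    have := congrFun (congrFun e22 (j, 0)) (j, 1)
    simp [pauliZ] at this
    unfold partner
    split_ifs at this ⊢ with h
    · rw [Real.mul_self_sqrt (by nlinarith [hν1 ⟨j, h⟩])] at this
      nlinarith [hν1 ⟨j, h⟩]
    · nlinarith
  rw [hμ, squeezedCov]

/-- The modewise decomposition of pure Gaussian states: local symplectic matrices bring the
covariance matrix of a bipartite pure state to that of a product of two-mode squeezed states. -/
theorem exists_modewise_decomposition {V : Matrix (JointQuad N M) (JointQuad N M) ℝ} (hV : Vᵀ = V)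
    (hpos : ∀ x, x ≠ 0 → 0 < gramForm V x x)
    (hVJ : V * jointSymplForm N M * V = jointSymplForm N M) :
    ∃ ν : Fin N → ℝ, (∀ i, 1 ≤ ν i) ∧ (∀ i : Fin N, M ≤ (i : ℕ) → ν i = 1) ∧
    ∃ (A : Matrix (Quad N) (Quad N) ℝ) (B : Matrix (Quad M) (Quad M) ℝ),
      IsSymplectic A ∧ IsSymplectic B ∧
      fromBlocks A 0 0 B * V * (fromBlocks A 0 0 B)ᵀ = squeezedCov M ν := by
  obtain ⟨P, C, C', Q, rfl⟩ : ∃ P C C' Q, V = fromBlocks P C C' Q :=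
    ⟨_, _, _, _, (fromBlocks_toBlocks V).symm⟩
  rw [fromBlocks_transpose] at hV
  obtain ⟨hP, -, hC', hQ⟩ := fromBlocks_inj.1 hV
  subst hC'
  have hPpos : ∀ x, x ≠ 0 → 0 < gramForm P x x := fun x hx => by
    have := hpos (Sum.elim x 0) (fun h => hx (by
      ext i; exact congrFun h (Sum.inl i)))
    rw [gramForm_apply, fromBlocks_mulVec] at this
    simpa [gramForm_apply] using this
  have hQpos : ∀ x, x ≠ 0 → 0 < gramForm Q x x := fun x hx => by
    have := hpos (Sum.elim 0 x) (fun h => hx (by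
      ext i; exact congrFun h (Sum.inr i)))
    rw [gramForm_apply, fromBlocks_mulVec] at this
    simpa [gramForm_apply] using this
  have hempty : IsNormalFamily (gramForm (symplForm N)) (gramForm P) (∅ : Finset (Fin N)) 0 0 0 :=
    ⟨by simp, by simp⟩
  -- Extending the empty family is Williamson's theorem for the data block. Sorting then puts the
  -- modes with `ν > 1` first, so that they meet ancilla modes of the same index.
  obtain ⟨ν, u, v, hfam, -⟩ := hempty.extend gramForm_symplForm_swap eq_zero_of_gramForm_symplForm
    (fun x y => by rw [gramForm_swap, hP]) hPpos (finrank_quad N)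
  let e := Tuple.sort fun i => -ν i
  have hanti : Antitone (ν ∘ e) := fun i j hij =>
    neg_le_neg_iff.1 (Tuple.monotone_sort (fun i => -ν i) hij)
  have hfam' := hfam.comp_equiv e
  have hA := hfam'.isSymplectic_pairRows
  have hAP := hfam'.pairRows_mul_mul_transpose
  set A := pairRows (u ∘ e) (v ∘ e)
  have hL := isJointSymplectic_fromBlocks hA (isSymplectic_one M)
  have hV2 := congr_mul_mul_congr (jointSymplForm_mul_self N M) hL hVJ
  have hblocks : fromBlocks A 0 0 1 * fromBlocks P C Cᵀ Q * (fromBlocks A 0 0 1)ᵀ =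
      fromBlocks (diagonal (ν ∘ e) ⊗ₖ (1 : Matrix (Fin 2) (Fin 2) ℝ)) (A * C) (A * C)ᵀ Q := by
    rw [fromBlocks_transpose, fromBlocks_multiply, fromBlocks_multiply]
    simp [hAP, transpose_mul]
  rw [hblocks] at hV2
  obtain ⟨h1, hM, B, hB, hfinal⟩ := exists_ancilla_reduction
    (fun i => (hfam'.1 i (Finset.mem_univ i)).pos hPpos) hanti hQ hQpos hV2
  refine ⟨ν ∘ e, h1, hM, A, B, hA, hB, ?_⟩
  rw [← hfinal, ← hblocks]
  have hAB : fromBlocks A 0 0 B = fromBlocks 1 0 0 B * fromBlocks A 0 0 1 := by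
    simp [fromBlocks_multiply]
  rw [hAB, transpose_mul]
  simp only [Matrix.mul_assoc]

theorem exists_isReductionGains {S : Matrix (JointQuad N M) (JointQuad N M) ℝ}
    (hS : IsJointSymplectic S) (σ : ℝ) : ∃ G : Fin N → ℝ, IsReductionGains S σ G := by
  have hJ := jointSymplForm_mul_self N M
  have hi := inv_mul_mul_inv_transpose hJ hS
  have hi' := transpose_mul_mul_of_sq_eq_neg_one hJ hi
  have hu : IsUnit (S⁻¹)ᵀ.det := by
    rw [det_transpose]
    exact isUnit_det_of_sq_eq_neg_one hJ hi
  obtain ⟨ν, h1, hM, A, B, hA, hB, hAB⟩ :=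
    exists_modewise_decomposition (V := S⁻¹ * (S⁻¹)ᵀ) (by simp) (fun x hx => by
      have hy : (S⁻¹)ᵀ *ᵥ x ≠ 0 := fun h => hx (by
        have := congrArg (((S⁻¹)ᵀ)⁻¹ *ᵥ ·) h
        simpa [mulVec_mulVec, nonsing_inv_mul _ hu] using this)
      rw [gramForm_apply, ← mulVec_mulVec, dotProduct_mulVec, ← mulVec_transpose]
      exact lt_of_le_of_ne (Finset.sum_nonneg fun i _ => mul_self_nonneg _)
        (fun h => hy (dotProduct_self_eq_zero.1 h.symm))) (by
      calc S⁻¹ * (S⁻¹)ᵀ * jointSymplForm N M * (S⁻¹ * (S⁻¹)ᵀ)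
          = S⁻¹ * ((S⁻¹)ᵀ * jointSymplForm N M * S⁻¹) * (S⁻¹)ᵀ := by simp only [Matrix.mul_assoc]
        _ = jointSymplForm N M := by rw [hi', hi])
  -- This inverts `ν = 2 G - 1`.
  refine ⟨fun i => (ν i + 1) / 2, fun i => by linarith [h1 i], fun i hi => by
    simp [hM i hi], A, B, hA, hB, ?_⟩
  rw [tmsProduct_mul_transpose _ (fun i => by linarith [h1 i]) (fun i hi => by
    simp [hM i hi]), noiseCov, Matrix.mul_smul, Matrix.smul_mul, hAB]
  congr 2; ext i; ring

end Reduction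
end O2O

theorem mainTheorem2 (N M : ℕ) (hN : 0 < N) (σ : ℝ) (hσ : 0 < σ)
    (S : Matrix (O2O.JointQuad N M) (O2O.JointQuad N M) ℝ) (hS : O2O.IsJointSymplectic S) :
    (∃ G : Fin N → ℝ, O2O.IsReductionGains S σ G) ∧
    ∀ G : Fin N → ℝ, O2O.IsReductionGains S σ G →
      ∀ (Y : Type*) [MeasurableSpace Y] (κ : Kernel (O2O.Quad M → ℝ) Y) [IsMarkovKernel κ]
        (f : Y → O2O.Quad N → ℝ), Measurable f →
        ENNReal.ofReal ((1 / (N : ℝ)) * ∑ i, σ ^ 2 / (2 * G i - 1)) ≤ O2O.rmsErrorSq S σ κ f ∧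
        ∀ Γ : ℝ, (1 / (N : ℝ)) * ∑ i, G i ≤ Γ →
          0 < σ ^ 2 / (2 * Γ - 1) ∧
          ENNReal.ofReal (σ ^ 2 / (2 * Γ - 1)) ≤ O2O.rmsErrorSq S σ κ f := by
  refine ⟨O2O.exists_isReductionGains hS σ, fun G hG Y _ κ _ f hf => ?_⟩
  have h := O2O.le_rmsErrorSq_of_isReductionGains hσ hG κ f hf
  refine ⟨h, fun Γ hΓ => ?_⟩
  obtain ⟨h0, h1⟩ := O2O.le_average_of_average_gain_le hN hσ hG.1 hΓ
  exact ⟨h0, (ENNReal.ofReal_le_ofReal h1).trans h⟩
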